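/- Noiseless group testing: among $n$ items, $k=k(n)$ are defective, where $k$ is known; a test of a pool of items is positive if and only if the pool contains a defective item. Fix $\theta\in[0,1)$ and let $k(n)=\Theta(n^\theta)$ as $n\to\infty$. In Bernoulli nonadaptive testing with $T$ tests and parameter $p\in[0,1]$, each item is placed in each test independently with probability $p$, and a detection algorithm estimates the defective set from the test design and the $T$ outcomes. Its average error probability is the probability that the estimate is wrong, averaged over all $\binom nk$ defective sets. A rate $R$ is achievable if there are $T=T(n)$ with $T\le\frac1R\log_2\binom nk$ for all large $n$, $p=p(n)$ and detection algorithms for which the average error probability tends to $0$ as $n\to\infty$. In adaptive testing, each pool may be chosen depending on the earlier outcomes (a decision tree), $T(n)$ bounds the number of tests used for every defective set of size $k$, and achievability of a rate is defined in the same way. The capacity of either kind of testing is the supremum of its achievable rates. (a) If $\theta\le 1/3$, then Bernoulli nonadaptive testing has capacity $1$, which is also the capacity of adaptive testing. (b) If $\theta>1/3$, then there is a constant $C<1$, depending only on $\theta$, such that the capacity of Bernoulli nonadaptive testing is at most $C$ for every $k(n)=\Theta(n^\theta)$, whereas the capacity of adaptive testing is $1$, and Hwang's generalized binary splitting algorithm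 achieves all rates below $1$. So Bernoulli nonadaptive testing is strictly worse than the best adaptive testing. -/

import Mathlib

open Filter Topology Asymptotics
open scoped NNReal ENNReal

noncomputable section

namespace GroupTesting

/-! ### Rates -/

/-- The supremum of all rates `R ≥ 0` with the property `P`, in `[0, ∞]`. -/
def supRate (P : ℝ≥0 → Prop) : ℝ≥0∞ := ⨆ (R : ℝ≥0) (_ : P R), (R : ℝ≥0∞)

/-- The number of bits `log₂ (n choose k)` needed to specify a defective set of size `k`. -/
def bits (n k : ℕ) : ℝ := Real.logb 2 (n.choose k : ℝ)

/-! ### Bernoulli nonadaptive testing -/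

/-- A test design for `n` items and `T` tests: `X i t = true` means that item `i` is in test `t`. -/
abbrev Design (n T : ℕ) : Type := Fin n → Fin T → Bool

/-- The outcomes of the tests of the design `X` if the defective set is `K`: a test is positive
exactly when it contains a defective item. -/
def outcome {n T : ℕ} (X : Design n T) (K : Finset (Fin n)) : Fin T → Bool :=
  fun t => decide (∃ i ∈ K, X i t = true)

/-- The probability of the design `X` when each item is placed in each test independently with
probability `p`. -/
def bernoulliWeight {n T : ℕ} (p : ℝ) (X : Design n T) : ℝ :=
  ∏ i, ∏ t, if X i t = true then p else 1 - p

/-- A detection algorithm estimates the defective set from the design and the outcomes. -/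
abbrev Detector (n T : ℕ) : Type := Design n T → (Fin T → Bool) → Finset (Fin n)

/-- The average error probability of the detection algorithm `D` under a Bernoulli(`p`) design,
averaged over all defective sets of size `k`. -/
def bernoulliError {n T : ℕ} (p : ℝ) (k : ℕ) (D : Detector n T) : ℝ :=
  (∑ K ∈ (Finset.univ : Finset (Fin n)).powersetCard k,
    ∑ X : Design n T, bernoulliWeight p X * (if D X (outcome X K) = K then 0 else 1))
    / (n.choose k : ℝ)

/-- The rate `R` is achievable by Bernoulli nonadaptive testing with `k n` defectives among `n`
items: for suitable numbers of tests `T n` with `bits n (k n) / T n ≥ R`, Bernoulli parameters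
`p n` and detection algorithms, the average error probability tends to `0`. -/
def BernoulliAchievable (k : ℕ → ℕ) (R : ℝ≥0) : Prop :=
  ∃ (T : ℕ → ℕ) (p : ℕ → ℝ) (D : ∀ n, Detector n (T n)),
    (∀ n, 0 ≤ p n ∧ p n ≤ 1) ∧
    (∀ᶠ n in atTop, (R : ℝ) * (T n : ℝ) ≤ bits n (k n)) ∧
    Tendsto (fun n => bernoulliError (p n) (k n) (D n)) atTop (𝓝 0)

/-- The capacity of Bernoulli nonadaptive testing with `k n` defectives among `n` items. -/
def bernoulliCapacity (k : ℕ → ℕ) : ℝ≥0∞ := supRate (BernoulliAchievable k)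

/-! ### Adaptive testing -/

/-- An adaptive scheme is a decision tree: it either stops and declares its estimate of the
defective set, or it tests a pool of items and continues according to the outcome. -/
inductive AdaptiveScheme (α : Type) : Type where
  | declare (S : Finset α) : AdaptiveScheme α
  | pool (A : Finset α) (ifNeg ifPos : AdaptiveScheme α) : AdaptiveScheme α

namespace AdaptiveScheme

variable {α : Type} [DecidableEq α]

/-- The set that the scheme declares if the defective set is `K`. -/
def estimate (K : Finset α) : AdaptiveScheme α → Finset α
  | declare S => S
  | pool A ifNeg ifPos =>
      if ∃ i ∈ A, i ∈ K then ifPos.estimate K else ifNeg.estimate K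

/-- The number of tests that the scheme performs if the defective set is `K`. -/
def numTests (K : Finset α) : AdaptiveScheme α → ℕ
  | declare _ => 0
  | pool A ifNeg ifPos =>
      (if ∃ i ∈ A, i ∈ K then ifPos.numTests K else ifNeg.numTests K) + 1

end AdaptiveScheme

/-- The average error probability of an adaptive scheme over all defective sets of size `k`. -/
def adaptiveError {n : ℕ} (k : ℕ) (S : AdaptiveScheme (Fin n)) : ℝ :=
  (∑ K ∈ (Finset.univ : Finset (Fin n)).powersetCard k,
    (if S.estimate K = K then (0 : ℝ) else 1)) / (n.choose k : ℝ)

/-- The sequence `S` of adaptive schemes achieves the rate `R` with `k n` defectives among `n`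
items: whatever the defective set, the number of tests is at most `bits n (k n) / R`, and the
average error probability tends to `0`. -/
def AchievesRate (k : ℕ → ℕ) (S : ∀ n, AdaptiveScheme (Fin n)) (R : ℝ≥0) : Prop :=
  (∀ᶠ n in atTop, ∀ K : Finset (Fin n), K.card = k n →
    (R : ℝ) * ((S n).numTests K : ℝ) ≤ bits n (k n)) ∧
  Tendsto (fun n => adaptiveError (k n) (S n)) atTop (𝓝 0)

/-- The capacity of adaptive testing with `k n` defectives among `n` items. -/
def adaptiveCapacity (k : ℕ → ℕ) : ℝ≥0∞ :=
  supRate (fun R => ∃ S : ∀ n, AdaptiveScheme (Fin n), AchievesRate k S R)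

/-! ### Hwang's generalized binary splitting -/

section Hwang

variable {α : Type} [DecidableEq α]

/-- Test each item of the list individually, and declare `found` together with the items that
tested positive. -/
def individual : List α → Finset α → AdaptiveScheme α
  | [], found => .declare found
  | x :: items, found =>
      .pool {x} (individual items found) (individual items (insert x found))

/-- Binary splitting of a group `G` of `2 ^ a` items that contains a defective: test the first
half; if it is positive, go on with it and return the other half to the unclassified items `rest`,
otherwise discard it and go on with the second half. Once a defective `x` is isolated, continue
with `next x rest`. (The case of an empty group does not occur.) -/
def binarySplit (next : α → List α → AdaptiveScheme α) :
    ℕ → List α → List α → AdaptiveScheme α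
  | 0, [], _ => .declare ∅
  | 0, x :: _, rest => next x rest
  | a + 1, G, rest =>
      .pool (G.take (2 ^ a)).toFinset
        (binarySplit next a (G.drop (2 ^ a)) rest)
        (binarySplit next a (G.take (2 ^ a)) (G.drop (2 ^ a) ++ rest))

/-- The exponent `⌊log₂ ((m - d + 1) / d)⌋` for the group size in generalized binary splitting
with `m ≥ 2 d - 1` unclassified items and `d ≥ 1` defectives among them. -/
def hwangExponent (m d : ℕ) : ℕ := Nat.log 2 ((m + 1 - d) / d)

/-- Generalized binary splitting on a list of unclassified items with `d` defectives among them,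
when the defectives in `found` have been found already. If no defective is left, stop. If there
are at most `2 d - 2` items, test them individually. Otherwise test a group of `2 ^ a` items,
where `a` is `hwangExponent`; discard it if it is negative; if it is positive, find a defective in
it by binary splitting. Repeat with the items that are left. -/
def hwangFrom : ℕ → List α → Finset α → AdaptiveScheme α
  | 0, _, found => .declare found
  | d + 1, items, found =>
      if _h : items.length ≤ 2 * d then individual items found
      else
        let a := hwangExponent items.length (d + 1)
        .pool (items.take (2 ^ a)).toFinset
          (hwangFrom (d + 1) (items.drop (2 ^ a)) found)
          (binarySplit (fun x rest => hwangFrom d rest (insert x found)) a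
            (items.take (2 ^ a)) (items.drop (2 ^ a)))
  termination_by d items => (d, items.length)
  decreasing_by
    · apply Prod.Lex.right
      have h2 : 0 < 2 ^ hwangExponent items.length (d + 1) := by positivity
      simp only [List.length_drop]
      omega
    · apply Prod.Lex.left
      omega

/-- Hwang's generalized binary splitting algorithm for `k` defectives among `n` items. -/
def hwang (k n : ℕ) : AdaptiveScheme (Fin n) := hwangFrom k (List.finRange n) ∅

end Hwang

/-- The supremum of the rates achieved by Hwang's generalized binary splitting algorithm with
`k n` defectives among `n` items. -/
def hwangRate (k : ℕ → ℕ) : ℝ≥0∞ := supRate (AchievesRate k (fun n => hwang (k n) n))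

end GroupTesting

end

/-!
For a defective set of size `k = Θ(n ^ θ)` with `θ < 1` the ratio `N = n / k` tends to infinity,
`bits n k` is `k * log₂ N` up to a term of order `k`, and the size of `k` is governed by the
comparison with powers of `N`: `k = O(N ^ (1 / 2))` if `θ ≤ 1 / 3`, and `k ≥ c * N ^ β` with
`β = θ / (1 - θ) > 1 / 2` if `θ > 1 / 3`.

No rate above `1` is achievable since `T` tests distinguish at most `2 ^ T` defective sets
(`le_bernoulliError_of_card`, `le_adaptiveError`). Generalized binary splitting makes no error and
uses at most `bits n k + 4 * k` tests: the potential `hwangBound` pays for every discarded group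
and for every defective found (`hwangFrom_spec`).

Expectations over a Bernoulli design of a product over the tests are powers of expectations over a
single pool (`designExp_prod`), and the probability that a pool avoids a set `S` is
`(1 - p) ^ S.card`. All events below are indicators of this kind or are bounded by such products
through exponential moments.

*Achievability for `θ ≤ 1 / 3`* (`bernoulliAchievable_of_lt_one`). Let every test be positive with
probability `1 / 2`, and declare any set of size `k` that explains the outcomes. A set `K'` that
misses `l` elements of the defective set `K` has the same outcomes with probability
`2 ^ (-T * l / k)`. If `l ≥ κ * k`, the union bound over all such `K'` suffices
(`designExp_confused_le`). If `l < κ * k`, let `L = K \ K'` and call a test pivotal if it meets `K`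
only in `L`. About `l * log N / 2` tests are pivotal, so that the probability of having a small
fraction of that number only is almost `N ^ (-l / 2)`, which beats the number of choices for `L`, at
most `k ^ l`, precisely because `k = O(N ^ (1 / 2))`. If there are many pivotal tests, then
`K' \ K` meets all of them with a probability of at most `N ^ (-3 * l)`, as each is met with
probability at most `l / k ≤ κ` (`designExp_confused_le_of_pivotal`).

*Converse for `θ > 1 / 3`* (`exists_bernoulliCapacity_le`). If a test is positive with a probability
away from `1 / 2`, then the outcomes lie with high probability in a set that is exponentially
smaller than `2 ^ T` (`le_bernoulliError_of_biased`). If the probability is close to `1 / 2`, then a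
given defective is masked, that is, never alone among the defectives in a test, with probability at
least about `N ^ (-1 / 2)`. Since `k` is much larger than `N ^ (1 / 2)`, the second moment method
gives a masked defective with high probability. A set `K` with a masked element `i` has the outcomes
of `K.erase i`, and there are far fewer sets of size `k - 1` than sets of size `k`, so that hardly
any `K` can be identified (`le_bernoulliError_of_masked`).
-/

namespace GroupTesting

/-! ### Expectations under the Bernoulli design -/

/-- The expectation of `F` under the Bernoulli(`p`) design. -/
noncomputable def designExp {n T : ℕ} (p : ℝ) (F : Design n T → ℝ) : ℝ :=
  ∑ X, bernoulliWeight p X * F X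

/-- The expectation of `f` of a single random pool that contains each item independently with
probability `p`; pools are encoded as columns of a design. -/
noncomputable def poolExp {n : ℕ} (p : ℝ) (f : (Fin n → Bool) → ℝ) : ℝ :=
  ∑ c : Fin n → Bool, (∏ i, if c i = true then p else 1 - p) * f c

/-- The indicator that the pool `c` contains no item of `S`. -/
noncomputable def noHit {n : ℕ} (S : Finset (Fin n)) (c : Fin n → Bool) : ℝ :=
  if ∃ i ∈ S, c i = true then 0 else 1

theorem bernoulliWeight_nonneg {n T : ℕ} {p : ℝ} (h0 : 0 ≤ p) (h1 : p ≤ 1) (X : Design n T) :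
    0 ≤ bernoulliWeight p X := by
  unfold bernoulliWeight
  refine Finset.prod_nonneg fun i _ => Finset.prod_nonneg fun t _ => ?_
  split_ifs <;> linarith

/-- The tests of a Bernoulli design are independent and identically distributed. -/
theorem designExp_prod {n T : ℕ} (p : ℝ) (f : (Fin n → Bool) → ℝ) :
    designExp p (fun X : Design n T => ∏ t, f (fun i => X i t)) = poolExp p f ^ T := by
  unfold designExp poolExp bernoulliWeight
  rw [Fintype.sum_pow]
  refine Fintype.sum_equiv (Equiv.piComm fun (_ : Fin n) (_ : Fin T) => Bool) _ _ fun X => ?_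
  rw [Finset.prod_comm, ← Finset.prod_mul_distrib]
  rfl

theorem poolExp_noHit {n : ℕ} (p : ℝ) (S : Finset (Fin n)) :
    poolExp p (noHit S) = (1 - p) ^ S.card := by
  let g : Fin n → Bool → ℝ := fun i b => if b = true then (if i ∈ S then 0 else p) else 1 - p
  have h : ∀ c : Fin n → Bool, (∏ i, if c i = true then p else 1 - p) * noHit S c =
      ∏ i, g i (c i) := by
    intro c
    unfold noHit
    split_ifs with h
    · obtain ⟨i, hi, hc⟩ := h
      rw [mul_zero, eq_comm]
      exact Finset.prod_eq_zero (Finset.mem_univ i) (by simp [g, hc, hi])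
    · rw [mul_one]
      refine Finset.prod_congr rfl fun i _ => ?_
      by_cases hc : c i = true
      · have : i ∉ S := fun hi => h ⟨i, hi, hc⟩
        simp [g, hc, this]
      · simp [g, hc]
  unfold poolExp
  rw [Finset.sum_congr rfl fun c _ => h c, ← Fintype.piFinset_univ,
    ← Finset.prod_univ_sum (fun _ => Finset.univ) g]
  rw [← Finset.prod_const, ← Finset.prod_subset (Finset.subset_univ S)]
  · exact Finset.prod_congr rfl fun i hi => by simp [g, hi]
  · intro i _ hi
    simp [g, hi]

theorem noHit_mul {n : ℕ} (S S' : Finset (Fin n)) (c : Fin n → Bool) :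
    noHit S c * noHit S' c = noHit (S ∪ S') c := by
  unfold noHit
  by_cases h : ∃ i ∈ S, c i = true <;> by_cases h' : ∃ i ∈ S', c i = true <;>
    simp only [Finset.mem_union, or_and_right, exists_or, h, h', if_true, if_false] <;> simp

theorem poolExp_add {n : ℕ} (p : ℝ) (f g : (Fin n → Bool) → ℝ) :
    poolExp p (fun c => f c + g c) = poolExp p f + poolExp p g := by
  simp [poolExp, mul_add, Finset.sum_add_distrib]

theorem poolExp_sub {n : ℕ} (p : ℝ) (f g : (Fin n → Bool) → ℝ) :
    poolExp p (fun c => f c - g c) = poolExp p f - poolExp p g := by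
  simp [poolExp, mul_sub, Finset.sum_sub_distrib]

theorem poolExp_const_mul {n : ℕ} (p a : ℝ) (f : (Fin n → Bool) → ℝ) :
    poolExp p (fun c => a * f c) = a * poolExp p f := by
  simp [poolExp, Finset.mul_sum, mul_left_comm]

theorem poolExp_const {n : ℕ} (p a : ℝ) : poolExp (n := n) p (fun _ => a) = a := by
  have h := poolExp_noHit (n := n) p ∅
  have h1 : noHit (n := n) ∅ = fun _ => 1 := by funext c; simp [noHit]
  have h2 := poolExp_const_mul (n := n) p a (fun _ => 1)
  rw [h1] at h
  rw [h] at h2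
  simpa using h2

theorem designExp_const {n T : ℕ} (p a : ℝ) : designExp (n := n) (T := T) p (fun _ => a) = a := by
  have h := designExp_prod (n := n) (T := T) p (fun _ => 1)
  rw [poolExp_const] at h
  simp only [designExp, Finset.prod_const_one, mul_one, one_pow] at h
  rw [designExp, ← Finset.sum_mul, h, one_mul]

theorem designExp_mono {n T : ℕ} {p : ℝ} (h0 : 0 ≤ p) (h1 : p ≤ 1) {F G : Design n T → ℝ}
    (h : ∀ X, F X ≤ G X) : designExp p F ≤ designExp p G :=
  Finset.sum_le_sum fun X _ => mul_le_mul_of_nonneg_left (h X) (bernoulliWeight_nonneg h0 h1 X)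

theorem designExp_add {n T : ℕ} (p : ℝ) (F G : Design n T → ℝ) :
    designExp p (fun X => F X + G X) = designExp p F + designExp p G := by
  simp [designExp, mul_add, Finset.sum_add_distrib]

theorem designExp_sub {n T : ℕ} (p : ℝ) (F G : Design n T → ℝ) :
    designExp p (fun X => F X - G X) = designExp p F - designExp p G := by
  simp [designExp, mul_sub, Finset.sum_sub_distrib]

theorem designExp_const_mul {n T : ℕ} (p a : ℝ) (F : Design n T → ℝ) :
    designExp p (fun X => a * F X) = a * designExp p F := by
  simp [designExp, Finset.mul_sum, mul_left_comm]

theorem designExp_sum {n T : ℕ} {ι : Type*} (p : ℝ) (s : Finset ι) (F : ι → Design n T → ℝ) :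
    designExp p (fun X => ∑ i ∈ s, F i X) = ∑ i ∈ s, designExp p (F i) := by
  simp only [designExp, Finset.mul_sum]
  exact Finset.sum_comm

/-! ### Errors of detection algorithms -/

theorem bernoulliError_eq {n T : ℕ} (p : ℝ) (k : ℕ) (D : Detector n T) :
    bernoulliError p k D = (∑ K ∈ (Finset.univ : Finset (Fin n)).powersetCard k,
      designExp p (fun X => if D X (outcome X K) = K then 0 else 1)) / (n.choose k : ℝ) := rfl

theorem bernoulliError_nonneg {n T : ℕ} {p : ℝ} (h0 : 0 ≤ p) (h1 : p ≤ 1) (k : ℕ)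
    (D : Detector n T) : 0 ≤ bernoulliError p k D := by
  unfold bernoulliError
  refine div_nonneg (Finset.sum_nonneg fun K _ => Finset.sum_nonneg fun X _ =>
    mul_nonneg (bernoulliWeight_nonneg h0 h1 X) ?_) (Nat.cast_nonneg _)
  split_ifs <;> norm_num

/-- If the defective sets that have the property `G` produce at most `B` different outcomes, and a
defective set fails to have it with probability at most `ε`, then no detection algorithm succeeds
with probability more than `ε + B / (n choose k)`: each outcome identifies at most one set. -/
theorem le_bernoulliError {n T k : ℕ} {p : ℝ} (h0 : 0 ≤ p) (h1 : p ≤ 1) (hk : k ≤ n)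
    (D : Detector n T) (G : Design n T → Finset (Fin n) → Prop)
    [∀ X, DecidablePred (G X)] {B ε : ℝ}
    (hB : ∀ X, ((((Finset.univ : Finset (Fin n)).powersetCard k).filter (G X)).image
      (outcome X)).card ≤ B)
    (hε : ∀ K : Finset (Fin n), K.card = k →
      designExp p (fun X : Design n T => if G X K then 0 else 1) ≤ ε) :
    1 - ε - B / (n.choose k : ℝ) ≤ bernoulliError p k D := by
  have hc : (0 : ℝ) < n.choose k := by exact_mod_cast Nat.choose_pos hk
  have hcard : (((Finset.univ : Finset (Fin n)).powersetCard k).card : ℝ) = n.choose k := by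
    simp [Finset.card_powersetCard]
  have key : ∀ X : Design n T, ∑ K ∈ (Finset.univ : Finset (Fin n)).powersetCard k,
      (if G X K ∧ D X (outcome X K) = K then (1 : ℝ) else 0) ≤ B := by
    intro X
    refine le_trans ?_ (hB X)
    rw [Finset.sum_boole]
    norm_cast
    rw [← Finset.card_image_of_injOn (f := outcome X)]
    · refine Finset.card_le_card (Finset.image_subset_image fun K hK => ?_)
      rw [Finset.mem_filter] at hK ⊢
      exact ⟨hK.1, hK.2.1⟩
    · intro K hK K' hK' h
      rw [Finset.mem_coe, Finset.mem_filter] at hK hK'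
      rw [← hK.2.2, ← hK'.2.2, h]
  have h2 : ∑ K ∈ (Finset.univ : Finset (Fin n)).powersetCard k,
      designExp p (fun X : Design n T => if G X K ∧ D X (outcome X K) = K then 1 else 0) ≤ B := by
    rw [← designExp_sum]
    exact (designExp_mono h0 h1 key).trans_eq (designExp_const p B)
  have h3 : ∀ K ∈ (Finset.univ : Finset (Fin n)).powersetCard k,
      1 - ε - designExp p (fun X : Design n T => if G X K ∧ D X (outcome X K) = K then 1 else 0)
        ≤ designExp p (fun X => if D X (outcome X K) = K then 0 else 1) := by
    intro K hK
    have h4 := hε K (Finset.mem_powersetCard.1 hK).2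
    have h5 : designExp p (fun _ : Design n T => 1) ≤
        designExp p (fun X : Design n T => (if D X (outcome X K) = K then 0 else 1) +
          ((if G X K then 0 else 1) + if G X K ∧ D X (outcome X K) = K then 1 else 0)) := by
      refine designExp_mono h0 h1 fun X => ?_
      by_cases a : G X K <;> by_cases b : D X (outcome X K) = K <;> simp [a, b]
    rw [designExp_const, designExp_add, designExp_add] at h5
    linarith
  rw [bernoulliError_eq, le_div_iff₀ hc, sub_mul, div_mul_cancel₀ _ hc.ne']
  refine le_trans ?_ (Finset.sum_le_sum h3)
  rw [Finset.sum_sub_distrib, Finset.sum_const, nsmul_eq_mul, hcard]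
  linarith

/-- The error is bounded below since `T` tests have only `2 ^ T` outcomes. -/
theorem le_bernoulliError_of_card {n T k : ℕ} {p : ℝ} (h0 : 0 ≤ p) (h1 : p ≤ 1) (hk : k ≤ n)
    (D : Detector n T) : 1 - 2 ^ T / (n.choose k : ℝ) ≤ bernoulliError p k D := by
  have := le_bernoulliError h0 h1 hk D (fun _ _ => True) (B := 2 ^ T) (ε := 0) (fun X => ?_)
    (fun K _ => by simp [designExp])
  · simpa using this
  · calc _ ≤ ((Finset.univ : Finset (Fin T → Bool)).card : ℝ) := by
          exact_mod_cast Finset.card_le_card (Finset.subset_univ _)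
      _ = 2 ^ T := by simp

/-! ### Counting bound for adaptive testing -/

/-- A decision tree of depth at most `T` has at most `2 ^ T` leaves, and each leaf is right for one
set only. -/
theorem adaptive_card_correct_le {α : Type} [DecidableEq α] (S : AdaptiveScheme α) (T : ℕ)
    (F : Finset (Finset α)) (h : ∀ K ∈ F, S.estimate K = K ∧ S.numTests K ≤ T) :
    F.card ≤ 2 ^ T := by
  induction S generalizing T F with
  | declare S =>
    refine (Finset.card_le_one.2 fun K hK K' hK' => ?_).trans Nat.one_le_two_pow
    rw [← (h K hK).1, ← (h K' hK').1]
    rfl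
  | pool A S₀ S₁ ih₀ ih₁ =>
    cases T with
    | zero =>
      have : F = ∅ := by
        refine Finset.eq_empty_of_forall_notMem fun K hK => ?_
        have := (h K hK).2
        simp [AdaptiveScheme.numTests] at this
      simp [this]
    | succ T =>
      rw [← Finset.card_filter_add_card_filter_not (fun K => ∃ i ∈ A, i ∈ K), pow_succ, mul_two]
      refine Nat.add_le_add (ih₁ T _ fun K hK => ?_) (ih₀ T _ fun K hK => ?_)
      all_goals
        rw [Finset.mem_filter] at hK
        have := h K hK.1
        simpa only [AdaptiveScheme.estimate, AdaptiveScheme.numTests, hK.2, if_true, if_false,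
          add_le_add_iff_right] using this

theorem le_adaptiveError {n k T : ℕ} (hk : k ≤ n) (S : AdaptiveScheme (Fin n))
    (hT : ∀ K : Finset (Fin n), K.card = k → S.numTests K ≤ T) :
    1 - 2 ^ T / (n.choose k : ℝ) ≤ adaptiveError k S := by
  have hc : (0 : ℝ) < n.choose k := by exact_mod_cast Nat.choose_pos hk
  have h1 := adaptive_card_correct_le S T
    (((Finset.univ : Finset (Fin n)).powersetCard k).filter fun K => S.estimate K = K)
    (fun K hK => by
      rw [Finset.mem_filter, Finset.mem_powersetCard] at hK
      exact ⟨hK.2, hT K hK.1.2⟩)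
  have h2 := Finset.card_filter_add_card_filter_not
    (s := (Finset.univ : Finset (Fin n)).powersetCard k) (fun K => S.estimate K = K)
  rw [Finset.card_powersetCard, Finset.card_univ, Fintype.card_fin] at h2
  unfold adaptiveError
  have h3 : ∑ K ∈ (Finset.univ : Finset (Fin n)).powersetCard k,
      (if S.estimate K = K then (0 : ℝ) else 1) =
      ((((Finset.univ : Finset (Fin n)).powersetCard k).filter
        fun K => ¬ S.estimate K = K).card : ℝ) := by
    rw [Finset.card_filter]
    push_cast
    exact Finset.sum_congr rfl fun K _ => by split_ifs <;> simp_all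
  rw [h3, le_div_iff₀ hc, sub_mul, div_mul_cancel₀ _ hc.ne', one_mul, ← h2]
  have h1' := (Nat.cast_le (α := ℝ)).2 h1
  push_cast at h1' ⊢
  linarith

theorem adaptiveError_eq_zero {n k : ℕ} {S : AdaptiveScheme (Fin n)}
    (h : ∀ K : Finset (Fin n), K.card = k → S.estimate K = K) : adaptiveError k S = 0 := by
  unfold adaptiveError
  rw [Finset.sum_eq_zero, zero_div]
  intro K hK
  rw [if_pos (h K (Finset.mem_powersetCard.1 hK).2)]

/-! ### Generalized binary splitting -/

section Hwang

variable {α : Type} [DecidableEq α]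

theorem estimate_individual (K : Finset α) (items : List α) (found : Finset α) :
    (individual items found).estimate K = found ∪ items.toFinset ∩ K := by
  induction items generalizing found with
  | nil => simp [individual, AdaptiveScheme.estimate]
  | cons x items ih =>
    ext y
    by_cases hx : x ∈ K
    · simp [individual, AdaptiveScheme.estimate, ih, hx]
    · simp [individual, AdaptiveScheme.estimate, ih, hx]

theorem numTests_individual (K : Finset α) (items : List α) (found : Finset α) :
    (individual items found).numTests K = items.length := by
  induction items generalizing found with
  | nil => rfl
  | cons x items ih => simp [individual, AdaptiveScheme.numTests, ih]

/-- Binary splitting isolates a defective of the group with one test per halving and loses no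
other defective: if the continuation is correct and takes at most `B` tests, then the whole scheme
is correct and takes at most `a + B` tests. -/
theorem binarySplit_spec (K : Finset α) (next : α → List α → AdaptiveScheme α) (B : ℝ) (a : ℕ)
    (G rest : List α) (hG : G.length ≤ 2 ^ a) (hnd : (G ++ rest).Nodup) (hpos : ∃ i ∈ G, i ∈ K)
    (hnext : ∀ x rest', x ∈ K → (x :: rest').Nodup → rest'.length < (G ++ rest).length →
      (x :: rest').toFinset ∩ K = (G ++ rest).toFinset ∩ K →
      (next x rest').estimate K = K ∧ ((next x rest').numTests K : ℝ) ≤ B) :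
    (binarySplit next a G rest).estimate K = K ∧
      ((binarySplit next a G rest).numTests K : ℝ) ≤ a + B := by
  induction a generalizing G rest with
  | zero =>
    match G, hpos with
    | x :: G', hpos =>
      have : G' = [] := by
        rw [← List.length_eq_zero_iff]; simpa using hG
      subst this
      have hx : x ∈ K := by simpa using hpos
      simpa [binarySplit] using hnext x rest hx (by simpa using hnd) (by simp) (by simp)
  | succ a ih =>
    have hsplit : G.take (2 ^ a) ++ G.drop (2 ^ a) = G := List.take_append_drop _ _
    have hlt : (G.take (2 ^ a)).length ≤ 2 ^ a := by simp
    have hld : (G.drop (2 ^ a)).length ≤ 2 ^ a := by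
      rw [List.length_drop]; rw [pow_succ] at hG; omega
    by_cases h : ∃ i ∈ G.take (2 ^ a), i ∈ K
    · have := ih (G.take (2 ^ a)) (G.drop (2 ^ a) ++ rest) hlt
        (by rwa [← List.append_assoc, hsplit]) h
        (by rwa [← List.append_assoc, hsplit])
      simp only [binarySplit, AdaptiveScheme.estimate, AdaptiveScheme.numTests, List.mem_toFinset,
        h, if_true]
      push_cast
      exact ⟨this.1, by linarith [this.2]⟩
    · have hsub : (G.drop (2 ^ a) ++ rest).Sublist (G ++ rest) :=
        (List.drop_sublist _ _).append_right _
      have hset : (G.drop (2 ^ a) ++ rest).toFinset ∩ K = (G ++ rest).toFinset ∩ K := by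
        conv_rhs => rw [← hsplit]
        ext y
        simp only [List.toFinset_append, Finset.mem_inter, Finset.mem_union, List.mem_toFinset]
        constructor
        · tauto
        · rintro ⟨(hy | hy) | hy, hK⟩
          · exact absurd ⟨y, hy, hK⟩ h
          · tauto
          · tauto
      have := ih (G.drop (2 ^ a)) rest hld (hnd.sublist hsub)
        (by
          obtain ⟨i, hi, hK⟩ := hpos
          rw [← hsplit, List.mem_append] at hi
          exact ⟨i, hi.resolve_left fun hi => h ⟨i, hi, hK⟩, hK⟩)
        (fun x rest' hx hn hl he =>
          hnext x rest' hx hn (hl.trans_le hsub.length_le) (he.trans hset))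
      simp only [binarySplit, AdaptiveScheme.estimate, AdaptiveScheme.numTests, List.mem_toFinset,
        h, if_false]
      push_cast
      exact ⟨this.1, by linarith [this.2]⟩

/-- A bound on the number of tests of generalized binary splitting with `m` unclassified items and
`d` defectives among them, for each choice of `b`. As a function of `b` it is smallest at the
exponent that the algorithm uses (`hwangBound_le`), where it drops by at least the number of tests
spent whenever a group is discarded or a defective is found. -/
noncomputable def hwangBound (m d b : ℕ) : ℝ := d * b + ((m : ℝ) + 1 - d) / 2 ^ b + 2 * d

/-- Up to the term `2 * d`, the bound is the value at `b` of a convex function, whose increment from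
`c` to `c + 1` changes sign where `2 ^ (c + 1) * d` passes `m + 1 - d`. -/
theorem hwangBound_le {m d : ℕ} (hd : 0 < d) (hm : 2 * d ≤ m + 1) (b : ℕ) :
    hwangBound m d (hwangExponent m d) ≤ hwangBound m d b := by
  have hq : (m + 1 - d) / d ≠ 0 := by
    rw [Nat.div_ne_zero_iff]; omega
  set a := hwangExponent m d with ha
  have h1 : 2 ^ a * d ≤ m + 1 - d :=
    (Nat.le_div_iff_mul_le hd).1 (Nat.pow_log_le_self 2 hq)
  have h2 : m + 1 - d < 2 ^ (a + 1) * d :=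
    (Nat.div_lt_iff_lt_mul hd).1 (Nat.lt_pow_succ_log_self one_lt_two _)
  have hcast : ((m + 1 - d : ℕ) : ℝ) = (m : ℝ) + 1 - d := by
    rw [Nat.cast_sub (by omega)]; push_cast; ring
  have h1' := (Nat.cast_le (α := ℝ)).2 h1
  have h2' := (Nat.cast_le (α := ℝ)).2 h2.le
  rw [hcast] at h1' h2'
  push_cast at h1' h2'
  have hstep : ∀ c : ℕ, hwangBound m d (c + 1) - hwangBound m d c =
      d - ((m : ℝ) + 1 - d) / 2 ^ (c + 1) := by
    intro c
    unfold hwangBound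
    have : (2 : ℝ) ^ c ≠ 0 := by positivity
    rw [pow_succ]
    push_cast
    field_simp
    ring
  rcases le_total a b with hab | hab
  · induction b, hab using Nat.le_induction with
    | base => exact le_rfl
    | succ c hc ih =>
      have h3 := hstep c
      have : ((m : ℝ) + 1 - d) / 2 ^ (c + 1) ≤ d := by
        rw [div_le_iff₀ (by positivity), mul_comm]
        refine h2'.trans ?_
        gcongr
        norm_num
      linarith
  · induction hab using Nat.decreasingInduction with
    | self => exact le_rfl
    | of_succ c hc ih =>
      have h3 := hstep c
      have : (d : ℝ) ≤ ((m : ℝ) + 1 - d) / 2 ^ (c + 1) := by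
        rw [le_div_iff₀ (by positivity), mul_comm]
        refine le_trans ?_ h1'
        gcongr
        · norm_num
        · exact hc
      linarith

/-- Generalized binary splitting finds all defectives that are among the unclassified items, within
the number of tests given by `hwangBound`. -/
theorem hwangFrom_spec (K : Finset α) (d : ℕ) (items : List α) (found : Finset α)
    (hnd : items.Nodup) (hK : ∀ y ∈ K, y ∈ found ∨ y ∈ items) (hf : found ⊆ K)
    (hd : (items.toFinset ∩ K).card = d) :
    (hwangFrom d items found).estimate K = K ∧
      ∀ b, ((hwangFrom d items found).numTests K : ℝ) ≤ hwangBound items.length d b := by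
  induction d generalizing items found with
  | zero =>
    rw [Finset.card_eq_zero] at hd
    rw [hwangFrom]
    refine ⟨?_, fun b => ?_⟩
    · refine Finset.Subset.antisymm hf fun y hy => (hK y hy).resolve_right fun h => ?_
      have : y ∈ items.toFinset ∩ K := by simp [h, hy]
      simp [hd] at this
    · simp only [AdaptiveScheme.numTests, hwangBound, Nat.cast_zero, sub_zero]
      positivity
  | succ d ihd =>
    induction hm : items.length using Nat.strong_induction_on generalizing items with
    | _ m ihm =>
      have hdm : d + 1 ≤ m := by
        rw [← hd, ← hm]
        exact (Finset.card_le_card Finset.inter_subset_left).trans (List.toFinset_card_le _)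
      rw [hwangFrom]
      by_cases hle : items.length ≤ 2 * d
      · rw [dif_pos hle]
        refine ⟨?_, fun b => ?_⟩
        · rw [estimate_individual]
          ext y
          have h1 := hK y
          have h2 := @hf y
          simp only [Finset.mem_union, Finset.mem_inter, List.mem_toFinset]
          tauto
        · rw [numTests_individual, hm]
          rw [hm] at hle
          have h1 : (m : ℝ) ≤ 2 * d := by exact_mod_cast hle
          have h2 : ((d + 1 : ℕ) : ℝ) ≤ m := by exact_mod_cast hdm
          have h3 : 0 ≤ ((m : ℝ) + 1 - (d + 1 : ℕ)) / 2 ^ b := by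
            apply div_nonneg <;> [linarith; positivity]
          have h4 : 0 ≤ ((d + 1 : ℕ) : ℝ) * b := by positivity
          unfold hwangBound
          push_cast at h3 h4 ⊢
          linarith
      · rw [dif_neg hle, hm]
        rw [hm] at hle
        set a := hwangExponent m (d + 1) with ha
        suffices h : ∀ S, S = _ → (AdaptiveScheme.estimate K S = K ∧
            (S.numTests K : ℝ) ≤ hwangBound m (d + 1) a) by
          exact ⟨(h _ rfl).1, fun b => (h _ rfl).2.trans
            (hwangBound_le (Nat.succ_pos d) (by omega) b)⟩
        rintro _ rfl
        have hq : (m + 1 - (d + 1)) / (d + 1) ≠ 0 := by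
          rw [Nat.div_ne_zero_iff]; omega
        have ham : 2 ^ a ≤ m := by
          have h1 : 2 ^ a ≤ (m + 1 - (d + 1)) / (d + 1) := Nat.pow_log_le_self 2 hq
          have h2 : (m + 1 - (d + 1)) / (d + 1) ≤ m + 1 - (d + 1) := Nat.div_le_self _ _
          omega
        have hsplit : items.take (2 ^ a) ++ items.drop (2 ^ a) = items := List.take_append_drop _ _
        simp only [AdaptiveScheme.estimate, AdaptiveScheme.numTests, List.mem_toFinset]
        by_cases h : ∃ i ∈ items.take (2 ^ a), i ∈ K
        · simp only [h, if_true]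
          have := binarySplit_spec K (fun x rest => hwangFrom d rest (insert x found))
            (hwangBound (m - 1) d a) a (items.take (2 ^ a)) (items.drop (2 ^ a)) (by simp)
            (by rwa [hsplit]) h
            (by
              rw [hsplit]
              intro x rest' hx hn hl he
              have hcard : (rest'.toFinset ∩ K).card = d := by
                rw [← he, List.toFinset_cons, Finset.insert_inter_of_mem hx,
                  Finset.card_insert_of_notMem] at hd
                · omega
                · simp [(List.nodup_cons.1 hn).1]
              have := ihd rest' (insert x found) (List.nodup_cons.1 hn).2
                (by
                  intro y hy
                  rcases hK y hy with h | h
                  · simp [h]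
                  · have : y ∈ items.toFinset ∩ K := by simp [h, hy]
                    rw [← he] at this
                    simp only [List.toFinset_cons, Finset.mem_inter, Finset.mem_insert,
                      List.mem_toFinset] at this
                    rw [Finset.mem_insert]
                    tauto)
                (Finset.insert_subset hx hf) hcard
              refine ⟨this.1, (this.2 a).trans ?_⟩
              have hl' : (rest'.length : ℝ) ≤ (m - 1 : ℕ) := by
                exact_mod_cast (by omega : rest'.length ≤ m - 1)
              unfold hwangBound
              gcongr)
          refine ⟨this.1, ?_⟩
          have h2 := this.2
          have hm1 : ((m - 1 : ℕ) : ℝ) = m - 1 := by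
            rw [Nat.cast_sub (by omega)]; simp
          unfold hwangBound at h2 ⊢
          rw [hm1] at h2
          push_cast at h2 ⊢
          have e : (m : ℝ) - 1 + 1 - d = m + 1 - (d + 1) := by ring
          rw [e] at h2
          linarith
        · simp only [h, if_false]
          have hset : (items.drop (2 ^ a)).toFinset ∩ K = items.toFinset ∩ K := by
            conv_rhs => rw [← hsplit]
            ext y
            simp only [List.toFinset_append, Finset.mem_inter, Finset.mem_union,
              List.mem_toFinset]
            constructor
            · tauto
            · rintro ⟨hy | hy, hK⟩
              · exact absurd ⟨y, hy, hK⟩ h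
              · tauto
          have hlen : (items.drop (2 ^ a)).length = m - 2 ^ a := by
            rw [List.length_drop, hm]
          have hpos : 0 < 2 ^ a := by positivity
          have := ihm (m - 2 ^ a) (by omega) (items.drop (2 ^ a))
            (hnd.sublist (List.drop_sublist _ _))
            (by
              intro y hy
              rcases hK y hy with h' | h'
              · exact Or.inl h'
              · rw [← hsplit, List.mem_append] at h'
                exact Or.inr (h'.resolve_left fun h' => h ⟨y, h', hy⟩))
            (by rw [hset, hd]) hlen
          refine ⟨this.1, ?_⟩
          have h2 := this.2 a
          unfold hwangBound at h2 ⊢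
          rw [Nat.cast_sub ham] at h2
          push_cast at h2 ⊢
          have h3 : ((m : ℝ) - 2 ^ a + 1 - (d + 1)) / 2 ^ a =
              ((m : ℝ) + 1 - (d + 1)) / 2 ^ a - 1 := by
            field_simp
            ring
          rw [h3] at h2
          linarith

theorem hwang_spec {n k : ℕ} (K : Finset (Fin n)) (hK : K.card = k) :
    (hwang k n).estimate K = K ∧ ∀ b, ((hwang k n).numTests K : ℝ) ≤ hwangBound n k b := by
  have := hwangFrom_spec K k (List.finRange n) ∅ (List.nodup_finRange n)
    (by simp [List.mem_finRange]) (by simp) (by simp [List.toFinset_finRange, hK])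
  simpa [hwang] using this

end Hwang

/-! ### Tests whose outcome is far from balanced carry less than one bit -/

theorem ite_outcome_eq {n T : ℕ} (X : Design n T) (K : Finset (Fin n)) (t : Fin T) (b : Bool)
    (x : ℝ) : (if outcome X K t = b then x else 1) =
      1 + (x - 1) * (if b = true then 1 - noHit K (fun i => X i t)
        else noHit K (fun i => X i t)) := by
  unfold outcome noHit
  by_cases h : ∃ i ∈ K, X i t = true <;> cases b <;> simp [h]

theorem exp_le_one_add_two_mul {x : ℝ} (h0 : 0 ≤ x) (h1 : x ≤ 1 / 2) : Real.exp x ≤ 1 + 2 * x := by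
  have h2 := Real.one_sub_le_exp_neg x
  rw [Real.exp_neg] at h2
  have h3 : Real.exp x * (1 - x) ≤ 1 := by
    calc _ ≤ Real.exp x * (Real.exp x)⁻¹ := by gcongr
      _ = 1 := mul_inv_cancel₀ (Real.exp_pos x).ne'
  nlinarith [Real.exp_pos x]

/-- The one-test factor in the Chernoff bound for the number of outcomes equal to `b`. -/
theorem chernoff_factor_le {δ P : ℝ} (h0 : 0 ≤ δ) (h1 : δ ≤ 1) (hP : P ≤ 1 / 2 - δ) :
    Real.exp (-(δ * (1 / 2 - δ / 2))) * (1 + (Real.exp δ - 1) * P) ≤ Real.exp (-(δ ^ 2 / 4)) := by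
  have e1 : Real.exp δ = Real.exp (δ / 2) * Real.exp (δ / 2) := by rw [← Real.exp_add]; ring_nf
  have e2 : Real.exp (δ / 2) * Real.exp (-(δ / 2)) = 1 := by rw [← Real.exp_add]; simp
  have hc := Real.cosh_le_exp_half_sq (δ / 2)
  have hs := Real.self_le_sinh_iff.2 (by linarith : 0 ≤ δ / 2)
  have h2 : 1 + (Real.exp δ - 1) * P ≤
      Real.exp (δ / 2) * (Real.cosh (δ / 2) - 2 * δ * Real.sinh (δ / 2)) := by
    have h3 : (Real.exp δ - 1) * P ≤ (Real.exp δ - 1) * (1 / 2 - δ) := by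
      have := Real.one_le_exp h0
      gcongr
    refine (add_le_add_right h3 1).trans_eq ?_
    rw [Real.cosh_eq, Real.sinh_eq, e1]
    linear_combination (-δ - 1 / 2) * e2
  have h4 : Real.cosh (δ / 2) - 2 * δ * Real.sinh (δ / 2) ≤ Real.exp (-(3 * δ ^ 2 / 4)) := by
    have h5 : Real.exp ((δ / 2) ^ 2 / 2) ≤ 1 + 2 * ((δ / 2) ^ 2 / 2) :=
      exp_le_one_add_two_mul (by positivity) (by nlinarith)
    have h6 := Real.one_sub_le_exp_neg (3 * δ ^ 2 / 4)
    nlinarith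
  calc _ ≤ Real.exp (-(δ * (1 / 2 - δ / 2))) *
        (Real.exp (δ / 2) * Real.exp (-(3 * δ ^ 2 / 4))) := by
        gcongr
        exact h2.trans (by gcongr)
    _ = _ := by
        rw [← Real.exp_add, ← Real.exp_add]
        ring_nf

/-- The one-test factor in the exponential moment bound for the number of outcome vectors. -/
theorem counting_factor_le (δ : ℝ) :
    Real.exp (2 * δ * (1 / 2 - δ / 2)) * (1 + Real.exp (-(2 * δ))) ≤
      2 * Real.exp (-(δ ^ 2 / 2)) := by
  have hc := Real.cosh_le_exp_half_sq δ
  have e : Real.exp (2 * δ * (1 / 2 - δ / 2)) * (1 + Real.exp (-(2 * δ))) =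
      2 * (Real.exp (-δ ^ 2) * Real.cosh δ) := by
    rw [Real.cosh_eq, mul_add, ← Real.exp_add, mul_one]
    have : 2 * (Real.exp (-δ ^ 2) * ((Real.exp δ + Real.exp (-δ)) / 2)) =
      Real.exp (-δ ^ 2) * Real.exp δ + Real.exp (-δ ^ 2) * Real.exp (-δ) := by ring
    rw [this, ← Real.exp_add, ← Real.exp_add]
    ring_nf
  rw [e]
  calc _ ≤ 2 * (Real.exp (-δ ^ 2) * Real.exp (δ ^ 2 / 2)) := by gcongr
    _ = _ := by rw [← Real.exp_add]; ring_nf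

/-- The number of vectors of `T` outcomes among which at most the fraction `1 / 2 - δ / 2` is equal
to `b`. -/
theorem card_outcomes_le {T : ℕ} (b : Bool) {δ : ℝ} (h0 : 0 ≤ δ) :
    (((Finset.univ : Finset (Fin T → Bool)).filter fun y =>
      (((Finset.univ.filter fun t => y t = b).card : ℕ) : ℝ) ≤ (1 / 2 - δ / 2) * T).card : ℝ) ≤
      2 ^ T * Real.exp (-(δ ^ 2 / 2)) ^ T := by
  rw [← mul_pow]
  refine le_trans ?_ (pow_le_pow_left₀ (by positivity) (counting_factor_le δ) T)
  have hsum : Real.exp (2 * δ * (1 / 2 - δ / 2)) * (1 + Real.exp (-(2 * δ))) =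
      ∑ c : Bool, Real.exp (2 * δ * (1 / 2 - δ / 2)) *
        (if c = b then Real.exp (-(2 * δ)) else 1) := by
    cases b <;> simp <;> ring
  rw [hsum, Fintype.sum_pow, Finset.card_filter]
  push_cast
  refine Finset.sum_le_sum fun y _ => ?_
  rw [Finset.prod_mul_distrib, Finset.prod_const, Finset.card_univ, Fintype.card_fin,
    Finset.prod_ite, Finset.prod_const_one, mul_one, Finset.prod_const, ← Real.exp_nat_mul,
    ← Real.exp_nat_mul, ← Real.exp_add]
  split_ifs with h
  · apply Real.one_le_exp
    nlinarith
  · positivity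

/-- If an outcome `b` of a test has probability at most `1 / 2 - δ`, then the outcomes of `T` tests
lie, up to an exponentially small probability, in a set that is smaller than `2 ^ T` by an
exponential factor. -/
theorem le_bernoulliError_of_biased {n T k : ℕ} {p : ℝ} (hp0 : 0 ≤ p) (hp1 : p ≤ 1) (hk : k ≤ n)
    (D : Detector n T) (b : Bool) {δ : ℝ} (h0 : 0 ≤ δ) (h1 : δ ≤ 1)
    (hb : (if b = true then 1 - (1 - p) ^ k else (1 - p) ^ k) ≤ 1 / 2 - δ) :
    1 - Real.exp (-(δ ^ 2 / 4)) ^ T - 2 ^ T * Real.exp (-(δ ^ 2 / 2)) ^ T / (n.choose k : ℝ) ≤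
      bernoulliError p k D := by
  classical
  refine le_bernoulliError hp0 hp1 hk D
    (fun X K => (((Finset.univ.filter fun t => outcome X K t = b).card : ℕ) : ℝ) ≤
      (1 / 2 - δ / 2) * T) (fun X => ?_) (fun K hK => ?_)
  · refine le_trans ?_ (card_outcomes_le b h0)
    norm_cast
    refine Finset.card_le_card fun y hy => ?_
    rw [Finset.mem_image] at hy
    obtain ⟨K, hK, rfl⟩ := hy
    simpa using (Finset.mem_filter.1 hK).2
  · set f : (Fin n → Bool) → ℝ := fun c => Real.exp (-(δ * (1 / 2 - δ / 2))) *
      (1 + (Real.exp δ - 1) * (if b = true then 1 - noHit K c else noHit K c)) with hf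
    have hfe : poolExp p f ≤ Real.exp (-(δ ^ 2 / 4)) := by
      rw [hf, poolExp_const_mul, poolExp_add, poolExp_const, poolExp_const_mul]
      refine (le_of_eq ?_).trans (chernoff_factor_le h0 h1 hb)
      congr 3
      split_ifs
      · rw [poolExp_sub, poolExp_const, poolExp_noHit, hK]
      · rw [← hK]; exact poolExp_noHit p K
    have hf0 : 0 ≤ poolExp p f := by
      refine Finset.sum_nonneg fun c _ => mul_nonneg (Finset.prod_nonneg fun i _ => ?_) ?_
      · split_ifs <;> linarith
      · have := Real.one_le_exp h0
        have h2 : noHit K c = 0 ∨ noHit K c = 1 := by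
          unfold noHit; split_ifs <;> simp
        apply mul_nonneg (Real.exp_pos _).le
        rcases h2 with h2 | h2 <;> rw [h2] <;> split_ifs <;> linarith
    refine le_trans ?_ (pow_le_pow_left₀ hf0 hfe T)
    rw [← designExp_prod]
    refine designExp_mono hp0 hp1 fun X => ?_
    have e : ∏ t, f (fun i => X i t) = Real.exp (-(δ * (1 / 2 - δ / 2))) ^ T *
        Real.exp δ ^ (Finset.univ.filter fun t => outcome X K t = b).card := by
      simp only [hf, ← ite_outcome_eq]
      rw [Finset.prod_mul_distrib, Finset.prod_const, Finset.card_univ, Fintype.card_fin,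
        Finset.prod_ite, Finset.prod_const_one, mul_one, Finset.prod_const]
    rw [e, ← Real.exp_nat_mul, ← Real.exp_nat_mul, ← Real.exp_add]
    split_ifs with h
    · positivity
    · apply Real.one_le_exp
      nlinarith [not_le.1 h]

/-! ### Masked defectives -/

/-- The defective `i` is masked in `K`: every test that contains it contains another element of
`K`, so that removing `i` from `K` does not change the outcomes. -/
def Masked {n T : ℕ} (X : Design n T) (K : Finset (Fin n)) (i : Fin n) : Prop :=
  ∀ t, X i t = true → ∃ j ∈ K.erase i, X j t = true

theorem Masked.outcome_erase {n T : ℕ} {X : Design n T} {K : Finset (Fin n)} {i : Fin n}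
    (h : Masked X K i) : outcome X (K.erase i) = outcome X K := by
  funext t
  unfold outcome
  rw [decide_eq_decide]
  constructor
  · rintro ⟨j, hj, hX⟩
    exact ⟨j, Finset.mem_of_mem_erase hj, hX⟩
  · rintro ⟨j, hj, hX⟩
    by_cases hji : j = i
    · exact h t (hji ▸ hX)
    · exact ⟨j, Finset.mem_erase.2 ⟨hji, hj⟩, hX⟩

/-- The indicator that `i` is the only element of `K` in the pool `c`. -/
noncomputable def sole {n : ℕ} (K : Finset (Fin n)) (i : Fin n) (c : Fin n → Bool) : ℝ :=
  noHit (K.erase i) c - noHit K c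

/-- Two defectives cannot both be alone in a test; this makes the events of being masked negatively
correlated. -/
theorem sole_mul_sole {n : ℕ} {K : Finset (Fin n)} {i j : Fin n} (hij : i ≠ j) (c : Fin n → Bool) :
    sole K i c * sole K j c = 0 := by
  have e1 : K.erase i ∪ K.erase j = K := by
    ext x
    simp only [Finset.mem_union, Finset.mem_erase]
    grind
  have e2 : K.erase i ∪ K = K := Finset.union_eq_right.2 (Finset.erase_subset _ _)
  have e3 : K ∪ K.erase j = K := Finset.union_eq_left.2 (Finset.erase_subset _ _)
  unfold sole
  rw [sub_mul, mul_sub, mul_sub, noHit_mul, noHit_mul, noHit_mul, noHit_mul, e1, e2, e3,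
    Finset.union_self]
  ring

theorem sole_eq_ite {n : ℕ} {K : Finset (Fin n)} {i : Fin n} (hi : i ∈ K) (c : Fin n → Bool) :
    sole K i c = if c i = true ∧ ¬ ∃ j ∈ K.erase i, c j = true then 1 else 0 := by
  unfold sole noHit
  have : (∃ j ∈ K, c j = true) ↔ c i = true ∨ ∃ j ∈ K.erase i, c j = true := by
    conv_lhs => rw [← Finset.insert_erase hi]
    rw [Finset.exists_mem_insert]
  rw [if_congr this rfl rfl]
  by_cases h1 : c i = true <;> by_cases h2 : ∃ j ∈ K.erase i, c j = true <;> simp only [h1, h2] <;>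
    simp

theorem poolExp_sole {n k : ℕ} (p : ℝ) {K : Finset (Fin n)} {i : Fin n} (hi : i ∈ K)
    (hK : K.card = k) : poolExp p (sole K i) = p * (1 - p) ^ (k - 1) := by
  have hk : k = (k - 1) + 1 := by
    have := Finset.card_pos.2 ⟨i, hi⟩
    omega
  unfold sole
  rw [poolExp_sub, poolExp_noHit, poolExp_noHit, Finset.card_erase_of_mem hi, hK]
  conv_lhs => rw [hk]
  simp only [Nat.add_sub_cancel, pow_succ]
  ring

open Classical in
theorem ite_masked_eq_prod {n T : ℕ} (X : Design n T) {K : Finset (Fin n)} {i : Fin n}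
    (hi : i ∈ K) :
    (if Masked X K i then (1 : ℝ) else 0) = ∏ t, (1 - sole K i (fun j => X j t)) := by
  simp only [sole_eq_ite hi]
  split_ifs with h
  · rw [Finset.prod_eq_one]
    intro t _
    rw [if_neg, sub_zero]
    exact fun ht => ht.2 (h t ht.1)
  · unfold Masked at h
    push Not at h
    obtain ⟨t, ht⟩ := h
    rw [eq_comm]
    refine Finset.prod_eq_zero (Finset.mem_univ t) ?_
    rw [if_pos, sub_self]
    refine ⟨ht.1, ?_⟩
    push Not
    exact ht.2

open Classical in
/-- The second moment method for the number of masked defectives: for two defectives, the events of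
being masked are negatively correlated. -/
theorem designExp_no_masked_le {n T k : ℕ} {p : ℝ} (hp0 : 0 ≤ p) (hp1 : p ≤ 1)
    (ha : p * (1 - p) ^ (k - 1) ≤ 1 / 2) (hk : 0 < k) {K : Finset (Fin n)} (hK : K.card = k) :
    designExp p (fun X : Design n T => if ∃ i ∈ K, Masked X K i then 0 else 1) ≤
      1 / (k * (1 - p * (1 - p) ^ (k - 1)) ^ T) := by
  set a := p * (1 - p) ^ (k - 1) with ha'
  set μ := (1 - a) ^ T with hμ
  have hμ0 : 0 < μ := pow_pos (by linarith) T
  have hk0 : (0 : ℝ) < k := by exact_mod_cast hk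
  set Y : Fin n → Design n T → ℝ := fun i X => if Masked X K i then 1 else 0 with hY
  have hE : ∀ i ∈ K, designExp p (Y i) = μ := by
    intro i hi
    have : Y i = fun X => ∏ t, (1 - sole K i (fun j => X j t)) := by
      funext X; exact ite_masked_eq_prod X hi
    rw [this]
    refine (designExp_prod p (fun c => 1 - sole K i c)).trans ?_
    rw [poolExp_sub, poolExp_const, poolExp_sole p hi hK]
  have hEE : ∀ i ∈ K, ∀ j ∈ K, i ≠ j → designExp p (fun X => Y i X * Y j X) ≤ μ ^ 2 := by
    intro i hi j hj hij
    have : (fun X => Y i X * Y j X) =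
        fun X => ∏ t, (1 - sole K i (fun j => X j t) - sole K j (fun j => X j t)) := by
      funext X
      simp only [hY]
      rw [ite_masked_eq_prod X hi, ite_masked_eq_prod X hj, ← Finset.prod_mul_distrib]
      refine Finset.prod_congr rfl fun t _ => ?_
      have := sole_mul_sole (K := K) hij (fun j => X j t)
      linear_combination this
    rw [this]
    refine (designExp_prod p (fun c => 1 - sole K i c - sole K j c)).trans_le ?_
    rw [poolExp_sub, poolExp_sub, poolExp_const, poolExp_sole p hi hK,
      poolExp_sole p hj hK, hμ, ← pow_mul, mul_comm T 2, pow_mul]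
    refine pow_le_pow_left₀ (by linarith) ?_ T
    nlinarith [sq_nonneg a]
  have hsq : designExp p (fun X => (∑ i ∈ K, Y i X - k * μ) ^ 2) ≤ k * μ := by
    have e : (fun X => (∑ i ∈ K, Y i X - k * μ) ^ 2) = fun X => (∑ i ∈ K, ∑ j ∈ K, Y i X * Y j X) -
        (2 * (k * μ)) * ∑ i ∈ K, Y i X + (k * μ) ^ 2 := by
      funext X
      rw [← Finset.sum_mul_sum]
      ring
    rw [e, designExp_add, designExp_sub, designExp_const_mul, designExp_const, designExp_sum,
      designExp_sum, Finset.sum_congr rfl hE, Finset.sum_const, nsmul_eq_mul, hK]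
    have h1 : ∀ i ∈ K, designExp p (fun X => ∑ j ∈ K, Y i X * Y j X) ≤ μ + k * μ ^ 2 := by
      intro i hi
      rw [designExp_sum, ← Finset.add_sum_erase _ _ hi]
      have h2 : designExp p (fun X => Y i X * Y i X) = μ := by
        rw [← hE i hi]
        congr 1
        funext X
        simp only [hY]
        split_ifs <;> simp
      have h3 : ∑ j ∈ K.erase i, designExp p (fun X => Y i X * Y j X) ≤ k * μ ^ 2 := by
        refine (Finset.sum_le_card_nsmul _ _ (μ ^ 2) fun j hj =>
          hEE i hi j (Finset.mem_of_mem_erase hj) (Finset.ne_of_mem_erase hj).symm).trans ?_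
        rw [nsmul_eq_mul]
        gcongr
        rw [← hK]
        exact Finset.card_le_card (Finset.erase_subset _ _)
      linarith
    have h4 := Finset.sum_le_sum h1
    rw [Finset.sum_const, nsmul_eq_mul, hK] at h4
    nlinarith
  have hle : designExp p (fun X : Design n T => if ∃ i ∈ K, Masked X K i then 0 else 1) ≤
      designExp p (fun X => (1 / (k * μ) ^ 2) * (∑ i ∈ K, Y i X - k * μ) ^ 2) := by
    refine designExp_mono hp0 hp1 fun X => ?_
    split_ifs with h
    · positivity
    · have : ∑ i ∈ K, Y i X = 0 :=
        Finset.sum_eq_zero fun i hi => if_neg fun hm => h ⟨i, hi, hm⟩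
      rw [this, zero_sub, neg_sq, one_div, inv_mul_cancel₀ (by positivity)]
  rw [designExp_const_mul] at hle
  refine hle.trans ?_
  calc _ ≤ 1 / (k * μ) ^ 2 * (k * μ) := by gcongr
    _ = _ := by field_simp

/-- A set with a masked defective has the outcomes of a set of size `k - 1`, and there are few of
those. -/
theorem le_bernoulliError_of_masked {n T k : ℕ} {p : ℝ} (hp0 : 0 ≤ p) (hp1 : p ≤ 1) (hk : k ≤ n)
    (ha : p * (1 - p) ^ (k - 1) ≤ 1 / 2) (hk0 : 0 < k) (D : Detector n T) :
    1 - 1 / (k * (1 - p * (1 - p) ^ (k - 1)) ^ T) - (n.choose (k - 1) : ℝ) / (n.choose k : ℝ) ≤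
      bernoulliError p k D := by
  classical
  refine le_bernoulliError hp0 hp1 hk D (fun X K => ∃ i ∈ K, Masked X K i) (fun X => ?_)
    (fun K hK => designExp_no_masked_le hp0 hp1 ha hk0 hK)
  refine le_trans (Nat.cast_le.2 ((Finset.card_le_card
    (t := ((Finset.univ : Finset (Fin n)).powersetCard (k - 1)).image (outcome X))
    fun y hy => ?_).trans Finset.card_image_le)) ?_
  · rw [Finset.mem_image] at hy ⊢
    obtain ⟨K, hK, rfl⟩ := hy
    obtain ⟨hK, i, hi, hm⟩ := Finset.mem_filter.1 hK
    rw [Finset.mem_powersetCard] at hK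
    refine ⟨K.erase i, ?_, hm.outcome_erase⟩
    simp [Finset.mem_powersetCard, Finset.card_erase_of_mem hi, hK.2]
  · rw [Finset.card_powersetCard, Finset.card_univ, Fintype.card_fin]

/-! ### A consistent detector and its error probability -/

/-- The detector that declares some set of size `k` that explains the outcomes. -/
noncomputable def consistentDetector (n T k : ℕ) : Detector n T := fun X y =>
  open Classical in
  if h : ∃ K : Finset (Fin n), K.card = k ∧ outcome X K = y then h.choose else ∅

/-- The event that the outcomes for the defective set `K` are explained by another set of the same
size that misses exactly `l` elements of `K`. -/
def Confused {n T : ℕ} (K : Finset (Fin n)) (l : ℕ) (X : Design n T) : Prop :=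
  ∃ L ∈ K.powersetCard l, ∃ L' ∈ Kᶜ.powersetCard l, outcome X (K \ L ∪ L') = outcome X K

open Classical in
theorem ite_error_le {n T k : ℕ} (X : Design n T) {K : Finset (Fin n)} (hK : K.card = k) :
    (if consistentDetector n T k X (outcome X K) = K then (0 : ℝ) else 1) ≤
      ∑ l ∈ Finset.Icc 1 k, if Confused K l X then 1 else 0 := by
  have hnn : ∀ l ∈ Finset.Icc 1 k, (0 : ℝ) ≤ if Confused K l X then 1 else 0 := by
    intro l _
    split_ifs <;> norm_num
  split_ifs with h
  · exact Finset.sum_nonneg hnn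
  · have hex : ∃ K' : Finset (Fin n), K'.card = k ∧ outcome X K' = outcome X K := ⟨K, hK, rfl⟩
    unfold consistentDetector at h
    rw [dif_pos hex] at h
    obtain ⟨h1, h2⟩ := hex.choose_spec
    set K' := hex.choose
    have hc : (K' \ K).card = (K \ K').card := by
      have e1 := Finset.card_sdiff_add_card_inter K K'
      have e2 := Finset.card_sdiff_add_card_inter K' K
      rw [Finset.inter_comm] at e2
      omega
    have hpos : 0 < (K \ K').card := by
      rw [Finset.card_pos, Finset.sdiff_nonempty]
      intro hsub
      exact h (Finset.eq_of_subset_of_card_le hsub (by omega)).symm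
    have hle : (K \ K').card ≤ k := hK ▸ Finset.card_le_card Finset.sdiff_subset
    refine le_trans ?_ (Finset.single_le_sum hnn (Finset.mem_Icc.2 ⟨hpos, hle⟩))
    rw [if_pos]
    refine ⟨K \ K', by simp [Finset.mem_powersetCard], K' \ K, ?_, ?_⟩
    · rw [Finset.mem_powersetCard]
      refine ⟨fun x hx => ?_, hc⟩
      rw [Finset.mem_compl]
      exact (Finset.mem_sdiff.1 hx).2
    · rw [← h2]
      congr 1
      ext x
      simp only [Finset.mem_union, Finset.mem_sdiff]
      tauto

open Classical in
theorem bernoulliError_consistentDetector_le {n T k : ℕ} {p : ℝ} (hp0 : 0 ≤ p) (hp1 : p ≤ 1)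
    (hk : k ≤ n) (ε : ℕ → ℝ)
    (h : ∀ l ∈ Finset.Icc 1 k, ∀ K : Finset (Fin n), K.card = k →
      designExp p (fun X : Design n T => if Confused K l X then 1 else 0) ≤ ε l) :
    bernoulliError p k (consistentDetector n T k) ≤ ∑ l ∈ Finset.Icc 1 k, ε l := by
  have hc : (0 : ℝ) < n.choose k := by exact_mod_cast Nat.choose_pos hk
  rw [bernoulliError_eq, div_le_iff₀ hc]
  refine (Finset.sum_le_card_nsmul _ _ (∑ l ∈ Finset.Icc 1 k, ε l) fun K hK => ?_).trans ?_
  · have hK' := (Finset.mem_powersetCard.1 hK).2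
    refine (designExp_mono hp0 hp1 fun X => ite_error_le X hK').trans ?_
    rw [designExp_sum]
    exact Finset.sum_le_sum fun l hl => h l hl K hK'
  · rw [nsmul_eq_mul, Finset.card_powersetCard, Finset.card_univ, Fintype.card_fin, mul_comm]

theorem card_powersetCard_compl_le {n : ℕ} (K : Finset (Fin n)) (l : ℕ) :
    ((Kᶜ.powersetCard l).card : ℝ) ≤ n.choose l := by
  rw [Finset.card_powersetCard]
  have : (Kᶜ).card ≤ n := by simpa using Finset.card_le_univ (Kᶜ)
  exact_mod_cast Nat.choose_le_choose l this

theorem outcome_eq_iff {n T : ℕ} (X : Design n T) (K K' : Finset (Fin n)) :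
    outcome X K' = outcome X K ↔
      ∀ t, ((∃ i ∈ K', X i t = true) ↔ ∃ i ∈ K, X i t = true) := by
  rw [funext_iff]
  exact forall_congr' fun t => decide_eq_decide

theorem card_sdiff_union {n k l : ℕ} {K L L' : Finset (Fin n)} (hK : K.card = k)
    (hL : L ∈ K.powersetCard l) (hL' : L' ∈ Kᶜ.powersetCard l) :
    (K \ L).card = k - l ∧ (K \ L ∪ L').card = k ∧ (K ∪ L').card = k + l ∧ l ≤ k := by
  rw [Finset.mem_powersetCard] at hL hL'
  have hd : Disjoint K L' :=
    Finset.disjoint_left.2 fun x hx hx' => Finset.mem_compl.1 (hL'.1 hx') hx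
  have h1 : (K \ L).card = k - l := by rw [Finset.card_sdiff_of_subset hL.1, hK, hL.2]
  have h2 : l ≤ k := by rw [← hK, ← hL.2]; exact Finset.card_le_card hL.1
  refine ⟨h1, ?_, ?_, h2⟩
  · rw [Finset.card_union_of_disjoint (hd.mono_left Finset.sdiff_subset), h1, hL'.2]
    omega
  · rw [Finset.card_union_of_disjoint hd, hK, hL'.2]

open Classical in
/-- The union bound over all sets that could be confused with `K`, which is good enough if they
miss a constant fraction of `K`. -/
theorem designExp_confused_le {n T k l : ℕ} {p : ℝ} (hp0 : 0 ≤ p) (hp1 : p ≤ 1)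
    {K : Finset (Fin n)} (hK : K.card = k) (hq : (1 - p) ^ k = 1 / 2) :
    designExp p (fun X : Design n T => if Confused K l X then 1 else 0) ≤
      (k.choose l : ℝ) * n.choose l * ((1 - p) ^ l) ^ T := by
  have h1 : ∀ X : Design n T, (if Confused K l X then (1 : ℝ) else 0) ≤
      ∑ L ∈ K.powersetCard l, ∑ L' ∈ Kᶜ.powersetCard l,
        if outcome X (K \ L ∪ L') = outcome X K then 1 else 0 := by
    intro X
    have hnn : ∀ L L' : Finset (Fin n),
        (0 : ℝ) ≤ if outcome X (K \ L ∪ L') = outcome X K then 1 else 0 := by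
      intro L L'
      split_ifs <;> norm_num
    split_ifs with h
    · obtain ⟨L, hL, L', hL', h⟩ := h
      refine le_trans ?_ (Finset.single_le_sum
        (fun L _ => Finset.sum_nonneg fun L' _ => hnn L L') hL)
      refine le_trans ?_ (Finset.single_le_sum (fun L' _ => hnn L L') hL')
      rw [if_pos h]
    · exact Finset.sum_nonneg fun L _ => Finset.sum_nonneg fun L' _ => hnn L L'
  refine (designExp_mono hp0 hp1 h1).trans ?_
  rw [designExp_sum]
  have h2 : ∀ L ∈ K.powersetCard l, ∀ L' ∈ Kᶜ.powersetCard l,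
      designExp p (fun X : Design n T => if outcome X (K \ L ∪ L') = outcome X K then 1 else 0) =
        ((1 - p) ^ l) ^ T := by
    intro L hL L' hL'
    obtain ⟨-, c2, c3, -⟩ := card_sdiff_union hK hL hL'
    have hun : K ∪ (K \ L ∪ L') = K ∪ L' := by
      ext x
      simp only [Finset.mem_union, Finset.mem_sdiff]
      tauto
    set f : (Fin n → Bool) → ℝ := fun c => 1 - noHit K c - noHit (K \ L ∪ L') c +
      2 * noHit (K ∪ L') c with hf
    have hf' : ∀ c, f c = if (∃ i ∈ K \ L ∪ L', c i = true) ↔ ∃ i ∈ K, c i = true then 1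
        else 0 := by
      intro c
      simp only [hf]
      rw [← hun, ← noHit_mul K]
      by_cases a : ∃ i ∈ K, c i = true <;> by_cases b : ∃ i ∈ K \ L ∪ L', c i = true
      · rw [noHit.eq_def K, noHit.eq_def (K \ L ∪ L'), if_pos a, if_pos b, if_pos (iff_of_true b a)]
        norm_num
      · rw [noHit.eq_def K, noHit.eq_def (K \ L ∪ L'), if_pos a, if_neg b,
          if_neg fun h => b (h.2 a)]
        norm_num
      · rw [noHit.eq_def K, noHit.eq_def (K \ L ∪ L'), if_neg a, if_pos b,
          if_neg fun h => a (h.1 b)]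
        norm_num
      · rw [noHit.eq_def K, noHit.eq_def (K \ L ∪ L'), if_neg a, if_neg b,
          if_pos (iff_of_false b a)]
        norm_num
    have hE : poolExp p f = (1 - p) ^ l := by
      rw [hf, poolExp_add, poolExp_sub, poolExp_sub, poolExp_const, poolExp_const_mul,
        poolExp_noHit, poolExp_noHit, poolExp_noHit, hK, c2, c3, pow_add, hq]
      ring
    rw [← hE, ← designExp_prod]
    congr 1
    funext X
    simp only [hf', Finset.prod_ite_zero, Finset.prod_const_one, outcome_eq_iff, Finset.mem_univ,
      true_imp_iff]
  rw [Finset.sum_congr rfl fun L hL => by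
    rw [designExp_sum, Finset.sum_congr rfl (h2 L hL), Finset.sum_const, nsmul_eq_mul],
    Finset.sum_const, nsmul_eq_mul, ← mul_assoc]
  have h0 : 0 ≤ 1 - p := by linarith
  rw [Finset.card_powersetCard l K, hK]
  gcongr
  exact_mod_cast card_powersetCard_compl_le K l

/-- The pool `c` is pivotal for the part `L` of the defective set `K`: the elements of `L` are the
only defectives in it. -/
def Pivotal {n : ℕ} (K L : Finset (Fin n)) (c : Fin n → Bool) : Prop :=
  (∃ i ∈ K, c i = true) ∧ ¬ ∃ i ∈ K \ L, c i = true

open Classical in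
theorem ite_pivotal {n : ℕ} (K L : Finset (Fin n)) (c : Fin n → Bool) (x : ℝ) :
    (if Pivotal K L c then x else 1) = 1 + (x - 1) * (noHit (K \ L) c - noHit K c) := by
  unfold Pivotal noHit
  have : (∃ i ∈ K \ L, c i = true) → ∃ i ∈ K, c i = true := fun ⟨i, hi, h⟩ =>
    ⟨i, (Finset.mem_sdiff.1 hi).1, h⟩
  by_cases h1 : ∃ i ∈ K \ L, c i = true
  · rw [if_pos h1, if_pos (this h1), if_neg fun h => h.2 h1]
    ring
  · by_cases h2 : ∃ i ∈ K, c i = true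
    · rw [if_neg h1, if_pos h2, if_pos ⟨h2, h1⟩]
      ring
    · rw [if_neg h1, if_neg h2, if_neg fun h => h2 h.1]
      ring

open Classical in
/-- The number of tests that are pivotal for the part `L` of the defective set `K`. -/
noncomputable def numPivotal {n T : ℕ} (K L : Finset (Fin n)) (X : Design n T) : ℕ :=
  (Finset.univ.filter fun t => Pivotal K L (fun i => X i t)).card

open Classical in
theorem prod_pivotal {n T : ℕ} (K L : Finset (Fin n)) (X : Design n T) (x : ℝ) :
    ∏ t, (if Pivotal K L (fun i => X i t) then x else 1) = x ^ numPivotal K L X := by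
  rw [Finset.prod_ite, Finset.prod_const_one, mul_one, Finset.prod_const, numPivotal]

open Classical in
/-- A Chernoff bound for the event that there are few pivotal tests. -/
theorem designExp_numPivotal_lt_le {n T k l : ℕ} {p : ℝ} (hp0 : 0 ≤ p) (hp1 : p ≤ 1)
    {K L : Finset (Fin n)} (hK : K.card = k) (hL : (K \ L).card = k - l) {B m : ℝ} (hB : 1 ≤ B) :
    designExp p (fun X : Design n T => if (numPivotal K L X : ℝ) < m then 1 else 0) ≤
      B ^ m * (1 - (1 - B⁻¹) * ((1 - p) ^ (k - l) - (1 - p) ^ k)) ^ T := by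
  set f : (Fin n → Bool) → ℝ := fun c => 1 + (B⁻¹ - 1) * (noHit (K \ L) c - noHit K c) with hf
  have hE : poolExp p f = 1 - (1 - B⁻¹) * ((1 - p) ^ (k - l) - (1 - p) ^ k) := by
    rw [hf, poolExp_add, poolExp_const, poolExp_const_mul, poolExp_sub, poolExp_noHit,
      poolExp_noHit, hK, hL]
    ring
  rw [← hE, ← designExp_prod, ← designExp_const_mul]
  refine designExp_mono hp0 hp1 fun X => ?_
  simp only [hf, ← ite_pivotal]
  rw [prod_pivotal, inv_pow, ← Real.rpow_natCast, ← Real.rpow_neg (by linarith),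
    ← Real.rpow_add (by linarith)]
  split_ifs with h
  · exact Real.one_le_rpow hB (by linarith)
  · positivity

open Classical in
/-- A set `L'` of nondefectives, independent of the pivotal tests, is unlikely to meet all of
them if there are many. -/
theorem designExp_le_numPivotal_le {n T k l : ℕ} {p : ℝ} (hp0 : 0 ≤ p) (hp1 : p ≤ 1)
    {K L L' : Finset (Fin n)} (hK : K.card = k) (hL : L ∈ K.powersetCard l)
    (hL' : L' ∈ Kᶜ.powersetCard l) {m : ℝ} (hh : 0 < 1 - (1 - p) ^ l) :
    designExp p (fun X : Design n T => if m ≤ numPivotal K L X ∧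
      ∀ t, Pivotal K L (fun i => X i t) → ∃ i ∈ L', X i t = true then 1 else 0) ≤
      (1 - (1 - p) ^ l) ^ m := by
  obtain ⟨c1, c2, c3, c4⟩ := card_sdiff_union hK hL hL'
  -- Each pivotal test is met by `L'` with probability `h`, so this weight has expectation one.
  set h := 1 - (1 - p) ^ l with h_def
  have hh1 : h ≤ 1 := by
    have : 0 ≤ (1 - p) ^ l := pow_nonneg (by linarith) l
    linarith
  set f : (Fin n → Bool) → ℝ := fun c => 1 - (noHit (K \ L) c - noHit K c) +
    h⁻¹ * (noHit (K \ L) c - noHit K c - noHit (K \ L ∪ L') c + noHit (K ∪ L') c) with hf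
  have hf' : ∀ c, f c = if Pivotal K L c then (1 - noHit L' c) * h⁻¹ else 1 := by
    intro c
    rw [ite_pivotal]
    simp only [hf, ← noHit_mul]
    ring
  have hE : poolExp p f = 1 := by
    rw [hf, poolExp_add, poolExp_sub, poolExp_const, poolExp_sub, poolExp_const_mul, poolExp_add,
      poolExp_sub, poolExp_sub, poolExp_noHit, poolExp_noHit, poolExp_noHit, poolExp_noHit,
      hK, c1, c2, c3]
    have e : (1 - p) ^ k = (1 - p) ^ (k - l) * (1 - p) ^ l := by
      rw [← pow_add]; congr 1; omega
    have e2 : (1 - p) ^ (k - l) - (1 - p) ^ k - (1 - p) ^ k + (1 - p) ^ (k + l) =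
        h * ((1 - p) ^ (k - l) - (1 - p) ^ k) := by
      rw [pow_add, e, h_def]; ring
    rw [e2, inv_mul_cancel_left₀ hh.ne']
    ring
  have key : designExp p (fun X : Design n T => h ^ m * ∏ t, f (fun i => X i t)) = h ^ m := by
    rw [designExp_const_mul, designExp_prod, hE, one_pow, mul_one]
  rw [← key]
  refine designExp_mono hp0 hp1 fun X => ?_
  simp only [hf']
  split_ifs with hX
  · have e : ∏ t, (if Pivotal K L (fun i => X i t) then
        (1 - noHit L' (fun i => X i t)) * h⁻¹ else 1) = h⁻¹ ^ numPivotal K L X := by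
      rw [← prod_pivotal]
      refine Finset.prod_congr rfl fun t _ => ?_
      split_ifs with ht
      · unfold noHit
        rw [if_pos (hX.2 t ht)]
        ring
      · rfl
    rw [e, inv_pow, ← Real.rpow_natCast, ← Real.rpow_neg hh.le, ← Real.rpow_add hh]
    exact Real.one_le_rpow_of_pos_of_le_one_of_nonpos hh hh1 (by linarith [hX.1])
  · refine mul_nonneg (Real.rpow_nonneg hh.le _) (Finset.prod_nonneg fun t _ => ?_)
    split_ifs
    · refine mul_nonneg ?_ (inv_nonneg.2 hh.le)
      unfold noHit
      split_ifs <;> norm_num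
    · norm_num

open Classical in
/-- The bound on the probability of confusion with a set that misses few defectives: a set that
replaces `L` by `L'` explains the outcomes only if `L'` meets all tests that are pivotal for `L`. -/
theorem designExp_confused_le_of_pivotal {n T k l : ℕ} {p : ℝ} (hp0 : 0 ≤ p) (hp1 : p ≤ 1)
    {K : Finset (Fin n)} (hK : K.card = k) {B m : ℝ} (hB : 1 ≤ B) (hh : 0 < 1 - (1 - p) ^ l) :
    designExp p (fun X : Design n T => if Confused K l X then 1 else 0) ≤
      (k.choose l : ℝ) * (B ^ m * (1 - (1 - B⁻¹) * ((1 - p) ^ (k - l) - (1 - p) ^ k)) ^ T +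
        n.choose l * (1 - (1 - p) ^ l) ^ m) := by
  have h1 : ∀ X : Design n T, (if Confused K l X then (1 : ℝ) else 0) ≤
      ∑ L ∈ K.powersetCard l, ((if (numPivotal K L X : ℝ) < m then 1 else 0) +
        ∑ L' ∈ Kᶜ.powersetCard l, if m ≤ numPivotal K L X ∧
          ∀ t, Pivotal K L (fun i => X i t) → ∃ i ∈ L', X i t = true then 1 else 0) := by
    intro X
    have hn1 : ∀ L : Finset (Fin n), (0 : ℝ) ≤ if (numPivotal K L X : ℝ) < m then 1 else 0 := by
      intro L
      split_ifs <;> norm_num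
    have hn2 : ∀ L L' : Finset (Fin n), (0 : ℝ) ≤ if m ≤ numPivotal K L X ∧
          ∀ t, Pivotal K L (fun i => X i t) → ∃ i ∈ L', X i t = true then 1 else 0 := by
      intro L L'
      split_ifs <;> norm_num
    have hn3 : ∀ L ∈ K.powersetCard l, (0 : ℝ) ≤ (if (numPivotal K L X : ℝ) < m then 1 else 0) +
        ∑ L' ∈ Kᶜ.powersetCard l, if m ≤ numPivotal K L X ∧
          ∀ t, Pivotal K L (fun i => X i t) → ∃ i ∈ L', X i t = true then 1 else 0 :=
      fun L _ => add_nonneg (hn1 L) (Finset.sum_nonneg fun L' _ => hn2 L L')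
    split_ifs with h
    · obtain ⟨L, hL, L', hL', h⟩ := h
      refine le_trans ?_ (Finset.single_le_sum hn3 hL)
      by_cases hm : (numPivotal K L X : ℝ) < m
      · rw [if_pos hm]
        exact le_add_of_nonneg_right (Finset.sum_nonneg fun L' _ => hn2 L L')
      · refine le_add_of_nonneg_of_le (hn1 L) ?_
        refine le_trans ?_ (Finset.single_le_sum (fun L' _ => hn2 L L') hL')
        rw [if_pos]
        refine ⟨not_lt.1 hm, fun t ht => ?_⟩
        obtain ⟨i, hi, hX⟩ := ((outcome_eq_iff X K _).1 h t).2 ht.1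
        rw [Finset.mem_union] at hi
        exact ⟨i, hi.resolve_left fun hi => ht.2 ⟨i, hi, hX⟩, hX⟩
    · exact Finset.sum_nonneg hn3
  refine (designExp_mono hp0 hp1 h1).trans ?_
  rw [designExp_sum, ← hK, ← Finset.card_powersetCard, ← nsmul_eq_mul]
  refine Finset.sum_le_card_nsmul _ _ _ fun L hL => ?_
  rw [designExp_add, designExp_sum]
  have hcL : (K \ L).card = k - l := by
    rw [Finset.mem_powersetCard] at hL
    rw [Finset.card_sdiff_of_subset hL.1, hK, hL.2]
  rw [hK]
  refine add_le_add (designExp_numPivotal_lt_le hp0 hp1 hK hcL hB) ?_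
  refine (Finset.sum_le_card_nsmul _ _ _ fun L' hL' =>
    designExp_le_numPivotal_le hp0 hp1 hK hL hL' hh).trans ?_
  rw [nsmul_eq_mul]
  gcongr
  exact_mod_cast card_powersetCard_compl_le K l

/-! ### Sparse defective sets -/

section Growth

variable {θ : ℝ} {k : ℕ → ℕ}

theorem eventually_pos_of_isTheta
    (hk : (fun n => (k n : ℝ)) =Θ[atTop] (fun n : ℕ => (n : ℝ) ^ θ)) :
    ∀ᶠ n in atTop, 1 ≤ k n := by
  obtain ⟨c, hc, h⟩ := hk.2.exists_pos
  filter_upwards [h.bound, eventually_gt_atTop 0] with n hn hn0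
  by_contra h0
  have : k n = 0 := by omega
  rw [this] at hn
  have h2 : (0 : ℝ) < (n : ℝ) ^ θ := Real.rpow_pos_of_pos (by exact_mod_cast hn0) θ
  rw [Real.norm_of_nonneg h2.le] at hn
  simp at hn
  linarith

theorem tendsto_ratio_of_isTheta (hθ1 : θ < 1)
    (hk : (fun n => (k n : ℝ)) =Θ[atTop] (fun n : ℕ => (n : ℝ) ^ θ)) :
    Tendsto (fun n : ℕ => (n : ℝ) / k n) atTop atTop := by
  obtain ⟨C, hC, h⟩ := hk.1.exists_pos
  have h1 : Tendsto (fun n : ℕ => C⁻¹ * (n : ℝ) ^ (1 - θ)) atTop atTop :=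
    ((tendsto_rpow_atTop (by linarith)).comp tendsto_natCast_atTop_atTop).const_mul_atTop
      (inv_pos.2 hC)
  refine tendsto_atTop_mono' _ ?_ h1
  filter_upwards [h.bound, eventually_gt_atTop 0, eventually_pos_of_isTheta hk] with n hn hn0 hk0
  have hn' : (0 : ℝ) < n := by exact_mod_cast hn0
  have hk' : (0 : ℝ) < k n := by exact_mod_cast hk0
  rw [Real.norm_of_nonneg hk'.le, Real.norm_of_nonneg (by positivity)] at hn
  rw [le_div_iff₀ hk', Real.rpow_sub hn', Real.rpow_one]
  calc C⁻¹ * (n / (n : ℝ) ^ θ) * k n ≤ C⁻¹ * (n / (n : ℝ) ^ θ) * (C * (n : ℝ) ^ θ) := by gcongr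
    _ = n := by field_simp

/-- This is the only use of `θ ≤ 1 / 3`, and the exponent `1 / 2` is what the bound on the number of
pivotal tests can afford. -/
theorem le_sqrt_ratio_of_isTheta (hθ : θ ≤ 1 / 3)
    (hk : (fun n => (k n : ℝ)) =Θ[atTop] (fun n : ℕ => (n : ℝ) ^ θ)) :
    ∃ C : ℝ, 0 < C ∧ ∀ᶠ n : ℕ in atTop, (k n : ℝ) ≤ C * ((n : ℝ) / k n) ^ (1 / 2 : ℝ) := by
  obtain ⟨C, hC, h⟩ := hk.1.exists_pos
  refine ⟨(C ^ 3) ^ (1 / 2 : ℝ), by positivity, ?_⟩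
  filter_upwards [h.bound, eventually_gt_atTop 0, eventually_pos_of_isTheta hk] with n hn hn0 hk0
  have hn' : (1 : ℝ) ≤ n := by exact_mod_cast hn0
  have hk' : (0 : ℝ) < k n := by exact_mod_cast hk0
  rw [Real.norm_of_nonneg hk'.le, Real.norm_of_nonneg (by positivity)] at hn
  have h2 : (k n : ℝ) ≤ C * (n : ℝ) ^ (1 / 3 : ℝ) :=
    hn.trans (mul_le_mul_of_nonneg_left (Real.rpow_le_rpow_of_exponent_le hn' hθ) hC.le)
  have h3 : (k n : ℝ) ^ 3 ≤ C ^ 3 * n := by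
    refine (pow_le_pow_left₀ hk'.le h2 3).trans_eq ?_
    rw [mul_pow, ← Real.rpow_natCast _ 3, ← Real.rpow_natCast _ 3, ← Real.rpow_mul (by linarith)]
    norm_num
  rw [← Real.mul_rpow (by positivity) (by positivity), ← Real.sqrt_eq_rpow]
  apply Real.le_sqrt_of_sq_le
  rw [← mul_div_assoc, le_div_iff₀ hk']
  linarith [pow_succ (k n : ℝ) 2]

/-- The exponent `θ / (1 - θ)` exceeds `1 / 2` exactly if `θ > 1 / 3`. -/
theorem rpow_ratio_le_of_isTheta (hθ1 : θ < 1)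
    (hk : (fun n => (k n : ℝ)) =Θ[atTop] (fun n : ℕ => (n : ℝ) ^ θ)) :
    ∃ c : ℝ, 0 < c ∧ ∀ᶠ n : ℕ in atTop, c * ((n : ℝ) / k n) ^ (θ / (1 - θ)) ≤ k n := by
  obtain ⟨C, hC, h⟩ := hk.2.exists_pos
  have h1θ : 0 < 1 - θ := by linarith
  refine ⟨(C ^ (1 / (1 - θ)))⁻¹, by positivity, ?_⟩
  filter_upwards [h.bound, eventually_gt_atTop 0, eventually_pos_of_isTheta hk] with n hn hn0 hk0
  have hn' : (0 : ℝ) < n := by exact_mod_cast hn0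
  have hk' : (0 : ℝ) < k n := by exact_mod_cast hk0
  rw [Real.norm_of_nonneg hk'.le, Real.norm_of_nonneg (by positivity)] at hn
  have h2 : ((n : ℝ) / k n) ^ θ ≤ C * (k n : ℝ) ^ (1 - θ) := by
    rw [Real.div_rpow hn'.le hk'.le, div_le_iff₀ (by positivity), mul_assoc, ← Real.rpow_add hk']
    simpa using hn
  have h3 : ((n : ℝ) / k n) ^ (θ / (1 - θ)) ≤ C ^ (1 / (1 - θ)) * k n := by
    have := Real.rpow_le_rpow (by positivity) h2 (one_div_pos.2 h1θ).le
    rw [← Real.rpow_mul (by positivity), Real.mul_rpow hC.le (by positivity),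
      ← Real.rpow_mul hk'.le, mul_one_div, mul_one_div, div_self h1θ.ne', Real.rpow_one] at this
    exact this
  rw [inv_mul_le_iff₀ (by positivity)]
  exact h3

end Growth

/-! ### Binomial coefficients -/

theorem pow_div_le_choose {n k : ℕ} (h0 : 1 ≤ k) (hk : k ≤ n) :
    ((n : ℝ) / k) ^ k ≤ n.choose k := by
  induction k, h0 using Nat.le_induction generalizing n with
  | base => simp
  | succ k h0 ih =>
    obtain ⟨n, rfl⟩ : ∃ m, n = m + 1 := ⟨n - 1, by omega⟩
    have hkn : k ≤ n := by omega
    have e := Nat.add_one_mul_choose_eq n k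
    have e' : ((n : ℝ) + 1) * n.choose k = (n + 1).choose (k + 1) * ((k : ℝ) + 1) := by
      exact_mod_cast e
    have h1 := ih hkn
    have hk0 : (0 : ℝ) < k := by exact_mod_cast h0
    have hle : ((n : ℝ) + 1) / (k + 1) ≤ n / k := by
      rw [div_le_div_iff₀ (by positivity) hk0]
      have : (k : ℝ) ≤ n := by exact_mod_cast hkn
      linarith
    rw [pow_succ]
    push_cast
    calc (((n : ℝ) + 1) / (k + 1)) ^ k * ((n + 1) / (k + 1))
        ≤ (n.choose k) * (((n : ℝ) + 1) / (k + 1)) := by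
          gcongr
          exact (pow_le_pow_left₀ (by positivity) hle k).trans h1
      _ = (n + 1).choose (k + 1) := by
          field_simp
          linarith

theorem choose_le_exp_mul_div_pow (n : ℕ) {l : ℕ} (hl : 1 ≤ l) :
    (n.choose l : ℝ) ≤ (Real.exp 1 * n / l) ^ l := by
  have hl0 : (0 : ℝ) < l := by exact_mod_cast hl
  have h1 : (l : ℝ) ^ l / l.factorial ≤ Real.exp 1 ^ l := by
    rw [← Real.exp_nat_mul, mul_one]
    exact Real.pow_div_factorial_le_exp _ hl0.le l
  refine (Nat.choose_le_pow_div l n).trans ?_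
  rw [div_pow, mul_pow, le_div_iff₀ (by positivity), div_mul_eq_mul_div, mul_div_assoc, mul_comm]
  gcongr

theorem mul_logb_le_bits {n k : ℕ} (h0 : 1 ≤ k) (hk : k ≤ n) :
    k * Real.logb 2 ((n : ℝ) / k) ≤ bits n k := by
  have h1 : (0 : ℝ) < k := by exact_mod_cast h0
  have h2 : (0 : ℝ) < n := h1.trans_le (by exact_mod_cast hk)
  rw [bits, ← Real.logb_pow]
  exact Real.logb_le_logb_of_le one_lt_two (by positivity) (pow_div_le_choose h0 hk)

theorem bits_mul_log_two_le {n k : ℕ} (h0 : 1 ≤ k) (hk : k ≤ n) :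
    bits n k * Real.log 2 ≤ k * (Real.log ((n : ℝ) / k) + 1) := by
  have h1 : (0 : ℝ) < k := by exact_mod_cast h0
  have h2 : (0 : ℝ) < n := h1.trans_le (by exact_mod_cast hk)
  rw [bits, Real.logb, div_mul_cancel₀ _ (Real.log_pos one_lt_two).ne']
  refine (Real.log_le_log (by exact_mod_cast Nat.choose_pos hk)
    (choose_le_exp_mul_div_pow n h0)).trans_eq ?_
  rw [Real.log_pow, mul_div_assoc, Real.log_mul (Real.exp_pos 1).ne' (by positivity), Real.log_exp,
    add_comm]

theorem two_rpow_bits {n k : ℕ} (hk : k ≤ n) : (2 : ℝ) ^ bits n k = n.choose k :=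
  Real.rpow_logb two_pos one_lt_two.ne' (by exact_mod_cast Nat.choose_pos hk)

theorem eventually_le_of_tendsto_ratio {k : ℕ → ℕ}
    (hN : Tendsto (fun n : ℕ => (n : ℝ) / k n) atTop atTop) : ∀ᶠ n in atTop, k n ≤ n := by
  filter_upwards [hN.eventually_ge_atTop 1] with n hn
  rcases Nat.eq_zero_or_pos (k n) with h | h
  · omega
  · rw [le_div_iff₀ (by exact_mod_cast h), one_mul] at hn
    exact_mod_cast hn

theorem tendsto_bits {k : ℕ → ℕ} (h0 : ∀ᶠ n in atTop, 1 ≤ k n)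
    (hN : Tendsto (fun n : ℕ => (n : ℝ) / k n) atTop atTop) :
    Tendsto (fun n => bits n (k n)) atTop atTop := by
  refine tendsto_atTop_mono' _ ?_ ((Real.tendsto_logb_atTop one_lt_two).comp hN)
  filter_upwards [h0, eventually_le_of_tendsto_ratio hN, hN.eventually_ge_atTop 1] with n h1 h2 h3
  refine le_trans ?_ (mul_logb_le_bits h1 h2)
  have h4 : 0 ≤ Real.logb 2 ((n : ℝ) / k n) := Real.logb_nonneg one_lt_two h3
  have h5 : (1 : ℝ) ≤ k n := by exact_mod_cast h1
  simp only [Function.comp]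
  nlinarith

/-! ### Suprema of rates -/

theorem supRate_le {P : ℝ≥0 → Prop} {C : ℝ≥0} (h : ∀ R, C < R → ¬ P R) : supRate P ≤ C :=
  iSup₂_le fun R hR => ENNReal.coe_le_coe.2 (not_lt.1 fun hC => h R hC hR)

theorem one_le_supRate {P : ℝ≥0 → Prop} (h : ∀ R, 0 < R → R < 1 → P R) : 1 ≤ supRate P := by
  refine le_of_forall_lt fun c hc => ?_
  obtain ⟨R, h1, h2⟩ := ENNReal.lt_iff_exists_nnreal_btwn.1 hc
  refine h1.trans_le (le_iSup₂_of_le R (h R ?_ (by exact_mod_cast h2)) le_rfl)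
  exact ENNReal.coe_pos.1 (bot_le.trans_lt h1)

/-! ### No rate above one is achievable -/

/-- The chance of success that the counting bound leaves, for tests at rate at least `R`. -/
theorem pow_div_choose_le {n k T : ℕ} {R : ℝ} (hk : k ≤ n) (hR : 0 < R)
    (hT : R * T ≤ bits n k) :
    (2 : ℝ) ^ T / n.choose k ≤ 2 ^ (-((1 - 1 / R) * bits n k)) := by
  rw [← two_rpow_bits hk, ← Real.rpow_natCast, ← Real.rpow_sub two_pos]
  refine Real.rpow_le_rpow_of_exponent_le one_le_two ?_
  have : (T : ℝ) ≤ bits n k / R := by rw [le_div_iff₀ hR]; linarith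
  have e : bits n k / R = 1 / R * bits n k := by ring
  linarith

theorem tendsto_two_rpow_neg_mul {u : ℕ → ℝ} (hu : Tendsto u atTop atTop) {c : ℝ} (hc : 0 < c) :
    Tendsto (fun n => (2 : ℝ) ^ (-(c * u n))) atTop (𝓝 0) := by
  have h := (tendsto_rpow_atBot_of_base_gt_one 2 one_lt_two).comp
    (tendsto_neg_atTop_atBot.comp (hu.const_mul_atTop hc))
  exact h

theorem not_tendsto_zero_of_half_le {e : ℕ → ℝ} (h : ∀ᶠ n in atTop, 1 / 2 ≤ e n) :
    ¬ Tendsto e atTop (𝓝 0) := fun ht => by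
  have := ge_of_tendsto ht h
  norm_num at this

theorem eventually_pow_div_choose_le {k : ℕ → ℕ} (h0 : ∀ᶠ n in atTop, 1 ≤ k n)
    (hN : Tendsto (fun n : ℕ => (n : ℝ) / k n) atTop atTop) {R : ℝ} (hR : 1 < R) :
    ∀ᶠ n in atTop, ∀ T : ℕ, R * T ≤ bits n (k n) → (2 : ℝ) ^ T / n.choose (k n) ≤ 1 / 2 := by
  have hc : 0 < 1 - 1 / R := by
    rw [sub_pos, div_lt_one (by linarith)]
    exact hR
  filter_upwards [eventually_le_of_tendsto_ratio hN,
    (tendsto_two_rpow_neg_mul (tendsto_bits h0 hN) hc).eventually_le_const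
      (by norm_num : (0 : ℝ) < 1 / 2)] with n h1 h2 T hT
  exact (pow_div_choose_le h1 (by linarith) hT).trans h2

theorem bernoulliCapacity_le_one {k : ℕ → ℕ} (h0 : ∀ᶠ n in atTop, 1 ≤ k n)
    (hN : Tendsto (fun n : ℕ => (n : ℝ) / k n) atTop atTop) : bernoulliCapacity k ≤ 1 := by
  refine supRate_le (C := 1) fun R hR ⟨T, p, D, hp, hT, he⟩ => ?_
  refine not_tendsto_zero_of_half_le ?_ he
  filter_upwards [hT, eventually_le_of_tendsto_ratio hN,
    eventually_pow_div_choose_le h0 hN (R := R) (by exact_mod_cast hR)] with n h1 h2 h3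
  have := le_bernoulliError_of_card (hp n).1 (hp n).2 h2 (D n)
  linarith [h3 _ h1]

theorem adaptiveCapacity_le_one {k : ℕ → ℕ} (h0 : ∀ᶠ n in atTop, 1 ≤ k n)
    (hN : Tendsto (fun n : ℕ => (n : ℝ) / k n) atTop atTop) : adaptiveCapacity k ≤ 1 := by
  refine supRate_le (C := 1) fun R hR ⟨S, hT, he⟩ => ?_
  refine not_tendsto_zero_of_half_le ?_ he
  have hR' : (1 : ℝ) < R := by exact_mod_cast hR
  filter_upwards [hT, eventually_le_of_tendsto_ratio hN,
    eventually_pow_div_choose_le h0 hN hR', (tendsto_bits h0 hN).eventually_ge_atTop 0]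
    with n h1 h2 h3 hb
  have := le_adaptiveError (T := ⌊bits n (k n) / R⌋₊) h2 (S n) (fun K hK => by
    refine Nat.le_floor ?_
    rw [le_div_iff₀ (by linarith)]
    linarith [h1 K hK])
  have h4 := h3 ⌊bits n (k n) / R⌋₊ (by
    have := Nat.floor_le (div_nonneg hb (by linarith : (0 : ℝ) ≤ R))
    rw [le_div_iff₀ (by linarith)] at this
    linarith)
  linarith

/-! ### Generalized binary splitting achieves all rates below one -/

theorem hwangBound_log_le {n k : ℕ} (h0 : 1 ≤ k) (hk : k ≤ n) :
    hwangBound n k (Nat.log 2 (n / k)) ≤ bits n k + 4 * k := by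
  have hk0 : (0 : ℝ) < k := by exact_mod_cast h0
  have hq : n / k ≠ 0 := by rw [Nat.div_ne_zero_iff]; omega
  set b := Nat.log 2 (n / k) with hb
  have h1 : 2 ^ b * k ≤ n := (Nat.le_div_iff_mul_le h0).1 (Nat.pow_log_le_self 2 hq)
  have h2 : n < 2 ^ (b + 1) * k :=
    (Nat.div_lt_iff_lt_mul h0).1 (Nat.lt_pow_succ_log_self one_lt_two _)
  have h1' : (2 : ℝ) ^ b * k ≤ n := by exact_mod_cast h1
  have h2' : (n : ℝ) ≤ 2 ^ (b + 1) * k := by exact_mod_cast h2.le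
  have h3 : (b : ℝ) ≤ Real.logb 2 ((n : ℝ) / k) := by
    rw [Real.le_logb_iff_rpow_le one_lt_two (div_pos (lt_of_lt_of_le (by positivity) h1') hk0),
      Real.rpow_natCast, le_div_iff₀ hk0]
    exact h1'
  have h4 : ((n : ℝ) + 1 - k) / 2 ^ b ≤ 2 * k := by
    rw [div_le_iff₀ (by positivity)]
    have : (1 : ℝ) ≤ k := by exact_mod_cast h0
    rw [pow_succ] at h2'
    linarith
  have h5 := mul_logb_le_bits h0 hk
  have h6 : (k : ℝ) * b ≤ k * Real.logb 2 ((n : ℝ) / k) := by gcongr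
  unfold hwangBound
  linarith

theorem hwang_achievesRate {k : ℕ → ℕ} (h0 : ∀ᶠ n in atTop, 1 ≤ k n)
    (hN : Tendsto (fun n : ℕ => (n : ℝ) / k n) atTop atTop) {R : ℝ≥0} (hR : R < 1) :
    AchievesRate k (fun n => hwang (k n) n) R := by
  have hR' : (R : ℝ) < 1 := by exact_mod_cast hR
  constructor
  · filter_upwards [h0, eventually_le_of_tendsto_ratio hN,
      ((Real.tendsto_logb_atTop one_lt_two).comp hN).eventually_ge_atTop (4 / (1 - (R : ℝ)))]
      with n h1 h2 h3 K hK
    have h4 := (hwang_spec K hK).2 (Nat.log 2 (n / k n))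
    have h5 := hwangBound_log_le h1 h2
    have h6 := mul_logb_le_bits h1 h2
    simp only [Function.comp] at h3
    rw [div_le_iff₀ (by linarith)] at h3
    have hk0 : (0 : ℝ) ≤ k n := Nat.cast_nonneg _
    have hR0 : (0 : ℝ) ≤ R := R.2
    calc (R : ℝ) * ((hwang (k n) n).numTests K : ℝ) ≤ R * (bits n (k n) + 4 * k n) := by
          gcongr; linarith
      _ ≤ bits n (k n) := by
          have h7 : (4 : ℝ) * k n ≤ (1 - R) * bits n (k n) := by
            calc (4 : ℝ) * k n ≤ Real.logb 2 ((n : ℝ) / k n) * (1 - R) * k n := by gcongr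
              _ = (1 - R) * (k n * Real.logb 2 ((n : ℝ) / k n)) := by ring
              _ ≤ _ := mul_le_mul_of_nonneg_left h6 (by linarith)
          nlinarith
  · have : (fun n => adaptiveError (k n) (hwang (k n) n)) = fun _ => 0 := by
      funext n
      exact adaptiveError_eq_zero fun K hK => (hwang_spec K hK).1
    rw [this]
    exact tendsto_const_nhds

theorem one_le_hwangRate {k : ℕ → ℕ} (h0 : ∀ᶠ n in atTop, 1 ≤ k n)
    (hN : Tendsto (fun n : ℕ => (n : ℝ) / k n) atTop atTop) : 1 ≤ hwangRate k :=
  one_le_supRate fun _ _ hR => hwang_achievesRate h0 hN hR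

theorem hwangRate_le_adaptiveCapacity (k : ℕ → ℕ) : hwangRate k ≤ adaptiveCapacity k :=
  iSup₂_le fun R hR => le_iSup₂_of_le R ⟨_, hR⟩ le_rfl

/-! ### Bernoulli testing achieves all rates below one for very sparse defective sets -/

/-- The Bernoulli parameter for which a test is positive with probability `1 / 2`. -/
noncomputable def balancedProb (k : ℕ) : ℝ := 1 - 2 ^ (-(1 / (k : ℝ)))

theorem balancedProb_mem (k : ℕ) : 0 ≤ balancedProb k ∧ balancedProb k ≤ 1 := by
  unfold balancedProb
  have h1 : (2 : ℝ) ^ (-(1 / (k : ℝ))) ≤ 1 :=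
    Real.rpow_le_one_of_one_le_of_nonpos one_le_two (neg_nonpos.2 (by positivity))
  have h2 : (0 : ℝ) < 2 ^ (-(1 / (k : ℝ))) := by positivity
  constructor <;> linarith

theorem one_sub_balancedProb_pow (k j : ℕ) :
    (1 - balancedProb k) ^ j = Real.exp (-(j / k * Real.log 2)) := by
  rw [balancedProb, sub_sub_cancel, ← Real.rpow_natCast, ← Real.rpow_mul two_pos.le,
    Real.rpow_def_of_pos two_pos]
  ring_nf

section Bounds

variable {n k l T : ℕ} {R : ℝ}

/-- The size of the plain union bound for `l ≥ κ * k`; it is a power of a quantity that tends to `0`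
as `n / k` grows if `R < 1`. -/
theorem union_bound_le {κ : ℝ} (hκ : 0 < κ) (hl : 1 ≤ l) (hlk : l ≤ k) (hκl : κ * k ≤ l)
    (hN : 0 < (n : ℝ) / k)
    (hT : k * (Real.log ((n : ℝ) / k) / R) - Real.log 2 ≤ T * Real.log 2) :
    (k.choose l : ℝ) * n.choose l * ((1 - balancedProb k) ^ l) ^ T ≤
      (2 ^ (1 / κ) * (Real.exp 1 / κ) * 2 * ((n : ℝ) / k) ^ (1 - 1 / R)) ^ l := by
  have hl0 : (0 : ℝ) < l := by exact_mod_cast hl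
  have hk1 : (1 : ℝ) ≤ k := by exact_mod_cast hl.trans hlk
  have ha : (k.choose l : ℝ) ≤ (2 ^ (1 / κ)) ^ l := by
    have h1 : (k.choose l : ℝ) ≤ 2 ^ k := by exact_mod_cast Nat.choose_le_two_pow k l
    refine h1.trans ?_
    rw [← Real.rpow_natCast, ← Real.rpow_natCast, ← Real.rpow_mul two_pos.le]
    refine Real.rpow_le_rpow_of_exponent_le one_le_two ?_
    rw [one_div_mul_eq_div, le_div_iff₀ hκ]
    linarith
  have hb : (n.choose l : ℝ) ≤ (Real.exp 1 / κ * ((n : ℝ) / k)) ^ l := by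
    refine (choose_le_exp_mul_div_pow n hl).trans ?_
    refine pow_le_pow_left₀ (by positivity) ?_ l
    rw [div_mul_div_comm]
    gcongr
  have hc : ((1 - balancedProb k) ^ l) ^ T ≤ (2 * ((n : ℝ) / k) ^ (-(1 / R))) ^ l := by
    have e : 2 * ((n : ℝ) / k) ^ (-(1 / R)) =
        Real.exp (Real.log 2 - Real.log ((n : ℝ) / k) / R) := by
      rw [Real.exp_sub, Real.exp_log two_pos, Real.rpow_neg hN.le, Real.rpow_def_of_pos hN,
        mul_one_div, ← div_eq_mul_inv]
    rw [one_sub_balancedProb_pow, e, ← Real.exp_nat_mul, ← Real.exp_nat_mul, Real.exp_le_exp]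
    have h2 : (l : ℝ) / k * (k * (Real.log ((n : ℝ) / k) / R) - Real.log 2) ≤
        l / k * (T * Real.log 2) := by gcongr
    have h3 : (l : ℝ) / k * (k * (Real.log ((n : ℝ) / k) / R)) =
        l * (Real.log ((n : ℝ) / k) / R) := by
      field_simp
    have h4 : (l : ℝ) / k ≤ l := div_le_self hl0.le hk1
    have h5 := mul_le_mul_of_nonneg_right h4 (Real.log_pos one_lt_two).le
    rw [mul_sub, h3] at h2
    linarith
  calc _ ≤ (2 ^ (1 / κ)) ^ l * (Real.exp 1 / κ * ((n : ℝ) / k)) ^ l *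
        (2 * ((n : ℝ) / k) ^ (-(1 / R))) ^ l := by
        gcongr
        rw [one_sub_balancedProb_pow]
        positivity
    _ = _ := by
        rw [← mul_pow, ← mul_pow, sub_eq_add_neg, Real.rpow_add hN, Real.rpow_one]
        ring

/-- The Chernoff bound for the number of pivotal tests: the mean number of pivotal tests is about
`l * log (n / k) / (2 * R)`. -/
theorem pivotal_chernoff_le {B δ : ℝ} (hB : 1 ≤ B) (hl : 1 ≤ l) (hlk : l ≤ k)
    (hT : k * (Real.log ((n : ℝ) / k) / R) - Real.log 2 ≤ T * Real.log 2) :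
    B ^ (δ * l * Real.log ((n : ℝ) / k)) * (1 - (1 - B⁻¹) *
      ((1 - balancedProb k) ^ (k - l) - (1 - balancedProb k) ^ k)) ^ T ≤
    Real.exp (1 + (δ * Real.log B - (1 - B⁻¹) / (2 * R)) * Real.log ((n : ℝ) / k)) ^ l := by
  have hl0 : (0 : ℝ) < l := by exact_mod_cast hl
  have hk1 : (1 : ℝ) ≤ k := by exact_mod_cast hl.trans hlk
  have hlk' : (l : ℝ) / k ≤ 1 := (div_le_one (by linarith)).2 (by exact_mod_cast hlk)
  have hB0 : 0 < B := by linarith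
  have hB1 : 0 ≤ 1 - B⁻¹ := sub_nonneg.2 (inv_le_one_of_one_le₀ hB)
  have hB2 : 1 - B⁻¹ ≤ 1 := by linarith [inv_pos.2 hB0]
  have hlog := Real.log_pos one_lt_two
  have hlog2 : Real.log 2 ≤ 1 := by linarith [Real.log_two_lt_d9]
  have hr : (1 - balancedProb k) ^ (k - l) - (1 - balancedProb k) ^ k =
      (Real.exp (l / k * Real.log 2) - 1) / 2 := by
    have e1 : -(((k - l : ℕ) : ℝ) / k * Real.log 2) = l / k * Real.log 2 - Real.log 2 := by
      rw [Nat.cast_sub hlk]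
      field_simp
      ring
    have e2 : -((k : ℝ) / k * Real.log 2) = -Real.log 2 := by
      rw [div_self (by linarith), one_mul]
    rw [one_sub_balancedProb_pow, one_sub_balancedProb_pow, e1, e2, Real.exp_sub, Real.exp_neg,
      Real.exp_log two_pos]
    ring
  set r := (1 - balancedProb k) ^ (k - l) - (1 - balancedProb k) ^ k with hr_def
  have hr1 : l / k * Real.log 2 / 2 ≤ r := by
    rw [hr]
    linarith [Real.add_one_le_exp (l / k * Real.log 2)]
  have hr2 : r ≤ 1 := by
    have h1 : (l : ℝ) / k * Real.log 2 ≤ Real.log 2 := mul_le_of_le_one_left hlog.le hlk'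
    have h2 := Real.exp_le_exp.2 h1
    rw [Real.exp_log two_pos] at h2
    rw [hr]
    linarith
  have hr0 : 0 ≤ r := le_trans (by positivity) hr1
  have hbase : (1 - (1 - B⁻¹) * r) ^ T ≤ Real.exp (-((1 - B⁻¹) * r)) ^ T := by
    refine pow_le_pow_left₀ ?_ (Real.one_sub_le_exp_neg _) T
    nlinarith
  have hrT : (l : ℝ) * (Real.log ((n : ℝ) / k) / (2 * R) - 1) ≤ T * r := by
    calc (l : ℝ) * (Real.log ((n : ℝ) / k) / (2 * R) - 1)
        ≤ l / k / 2 * (k * (Real.log ((n : ℝ) / k) / R) - Real.log 2) := by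
          have h3 : (l : ℝ) / k / 2 * (k * (Real.log ((n : ℝ) / k) / R)) =
              l * (Real.log ((n : ℝ) / k) / (2 * R)) := by
            field_simp
          have h4 : (l : ℝ) / k / 2 * Real.log 2 ≤ l := by
            have := div_le_self hl0.le hk1
            nlinarith
          rw [mul_sub, mul_sub, h3]
          linarith
      _ ≤ l / k / 2 * (T * Real.log 2) := by gcongr
      _ = T * (l / k * Real.log 2 / 2) := by ring
      _ ≤ T * r := by gcongr
  calc _ ≤ B ^ (δ * l * Real.log ((n : ℝ) / k)) * Real.exp (-((1 - B⁻¹) * r)) ^ T := by gcongr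
    _ ≤ _ := by
      rw [Real.rpow_def_of_pos hB0, ← Real.exp_nat_mul, ← Real.exp_nat_mul, ← Real.exp_add,
        Real.exp_le_exp]
      have h5 := mul_le_mul_of_nonneg_left hrT hB1
      have h6 : (1 - B⁻¹) * l ≤ l := mul_le_of_le_one_left hl0.le hB2
      have e3 : (1 - B⁻¹) * (l * (Real.log ((n : ℝ) / k) / (2 * R) - 1)) =
          l * ((1 - B⁻¹) / (2 * R) * Real.log ((n : ℝ) / k)) - (1 - B⁻¹) * l := by ring
      rw [e3] at h5
      have e4 : (l : ℝ) * (1 + (δ * Real.log B - (1 - B⁻¹) / (2 * R)) *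
          Real.log ((n : ℝ) / k)) = l + l * (δ * Real.log B * Real.log ((n : ℝ) / k)) -
            l * ((1 - B⁻¹) / (2 * R) * Real.log ((n : ℝ) / k)) := by ring
      rw [e4]
      linarith

/-- The bound on `l / k` makes every pivotal test so unlikely to be met that `δ * l * log (n / k)` of
them exclude all replacements. -/
theorem meet_all_pivotal_le {δ : ℝ} (hδ : 0 < δ) (hl : 1 ≤ l) (hN : 1 ≤ (n : ℝ) / k)
    (hlκ : (l : ℝ) / k ≤ Real.exp (-(3 / δ))) :
    (1 - (1 - balancedProb k) ^ l) ^ (δ * l * Real.log ((n : ℝ) / k)) ≤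
      (((n : ℝ) / k) ^ (-3 : ℝ)) ^ l := by
  have hl0 : (0 : ℝ) < l := by exact_mod_cast hl
  have hN0 : 0 < (n : ℝ) / k := by linarith
  have hlogN := Real.log_nonneg hN
  have hlog2 : Real.log 2 ≤ 1 := by linarith [Real.log_two_lt_d9]
  have hm := balancedProb_mem k
  have h0 : 0 ≤ 1 - (1 - balancedProb k) ^ l :=
    sub_nonneg.2 (pow_le_one₀ (by linarith) (by linarith))
  have h1 : 1 - (1 - balancedProb k) ^ l ≤ Real.exp (-(3 / δ)) := by
    refine le_trans ?_ hlκ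
    rw [one_sub_balancedProb_pow]
    have h2 := Real.one_sub_le_exp_neg ((l : ℝ) / k * Real.log 2)
    have h3 : (l : ℝ) / k * Real.log 2 ≤ l / k := mul_le_of_le_one_right (by positivity) hlog2
    linarith
  refine (Real.rpow_le_rpow h0 h1 (by positivity)).trans_eq ?_
  rw [← Real.exp_mul, Real.rpow_def_of_pos hN0, ← Real.exp_nat_mul]
  congr 1
  field_simp

end Bounds

theorem sum_Icc_pow_le {x : ℝ} (h0 : 0 ≤ x) (h1 : x ≤ 1 / 2) (k : ℕ) :
    ∑ l ∈ Finset.Icc 1 k, x ^ l ≤ 2 * x := by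
  have h : ∑ l ∈ Finset.Icc 1 k, x ^ l ≤ 2 * x - 2 * x ^ (k + 1) := by
    induction k with
    | zero => simp
    | succ k ih =>
      rw [Finset.sum_Icc_succ_top (by omega)]
      have : x ^ (k + 1 + 1) ≤ x ^ (k + 1) * (1 / 2) := by
        rw [pow_succ]
        gcongr
      linarith
  linarith [pow_nonneg h0 (k + 1)]

/-- A rate `R < 1` is achieved by balanced tests and a consistent detector. Sets that miss at least
`κ * k` defectives are excluded by the plain union bound, and sets that miss fewer because every
part of the defective set has many pivotal tests; the latter needs that `k` is at most of order
`(n / k) ^ (1 / 2)`. -/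
theorem bernoulliAchievable_of_lt_one {k : ℕ → ℕ} (h0 : ∀ᶠ n in atTop, 1 ≤ k n)
    (hN : Tendsto (fun n : ℕ => (n : ℝ) / k n) atTop atTop) {C : ℝ} (hC : 0 < C)
    (hk : ∀ᶠ n : ℕ in atTop, (k n : ℝ) ≤ C * ((n : ℝ) / k n) ^ (1 / 2 : ℝ)) {R : ℝ≥0} (hR0 : 0 < R)
    (hR1 : R < 1) : BernoulliAchievable k R := by
  have hR0' : (0 : ℝ) < R := by exact_mod_cast hR0
  have hR1' : (R : ℝ) < 1 := by exact_mod_cast hR1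
  have hlog2 := Real.log_pos one_lt_two
  -- The parameters are chosen such that `(1 - 1 / B) / (2 * R) = 1 / 2 + 2 * η`.
  set B : ℝ := 2 / (1 - R) with hB
  set η : ℝ := (1 - R) / (8 * R) with hη
  set δ : ℝ := η / Real.log B with hδ
  set κ : ℝ := Real.exp (-(3 / δ)) with hκ
  have hB1 : 1 < B := by
    rw [hB, lt_div_iff₀ (by linarith)]
    linarith
  have hη0 : 0 < η := div_pos (by linarith) (by linarith)
  have hδ0 : 0 < δ := div_pos hη0 (Real.log_pos hB1)
  have hκ0 : 0 < κ := Real.exp_pos _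
  have hexp : δ * Real.log B - (1 - B⁻¹) / (2 * R) = -(1 / 2 + η) := by
    rw [hδ, div_mul_cancel₀ _ (Real.log_pos hB1).ne', hB, hη, inv_div]
    field_simp
    ring
  set T : ℕ → ℕ := fun n => ⌊k n * Real.logb 2 ((n : ℝ) / k n) / R⌋₊ with hT
  set x : ℕ → ℝ := fun n =>
    2 ^ (1 / κ) * (Real.exp 1 / κ) * 2 * ((n : ℝ) / k n) ^ (1 - 1 / (R : ℝ)) with hx
  set y : ℕ → ℝ := fun n => C * Real.exp 1 * ((n : ℝ) / k n) ^ (-η) with hy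
  set z : ℕ → ℝ := fun n => C ^ 2 * ((n : ℝ) / k n) ^ (-1 : ℝ) with hz
  have hlim : ∀ a s : ℝ, s < 0 →
      Tendsto (fun n : ℕ => a * ((n : ℝ) / k n) ^ s) atTop (𝓝 0) := by
    intro a s hs
    have := ((tendsto_rpow_neg_atTop (neg_pos.2 hs)).comp hN).const_mul a
    simpa [Function.comp_def] using this
  have hx0 : Tendsto x atTop (𝓝 0) := hlim _ _ (by
    rw [sub_neg, lt_div_iff₀ hR0']
    linarith)
  have hy0 : Tendsto y atTop (𝓝 0) := hlim _ _ (by linarith)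
  have hz0 : Tendsto z atTop (𝓝 0) := hlim _ _ (by norm_num)
  refine ⟨T, fun n => balancedProb (k n), fun n => consistentDetector n (T n) (k n),
    fun n => balancedProb_mem _, ?_, ?_⟩
  · filter_upwards [h0, eventually_le_of_tendsto_ratio hN, hN.eventually_ge_atTop 1]
      with n h1 h2 h3
    refine le_trans ?_ (mul_logb_le_bits h1 h2)
    have h4 : 0 ≤ k n * Real.logb 2 ((n : ℝ) / k n) / R :=
      div_nonneg (mul_nonneg (Nat.cast_nonneg _) (Real.logb_nonneg one_lt_two h3)) hR0'.le
    have h5 := Nat.floor_le h4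
    rw [le_div_iff₀ hR0'] at h5
    rw [mul_comm]
    exact h5
  · have hlim2 : Tendsto (fun n => 2 * x n + 2 * y n + 2 * z n) atTop (𝓝 0) := by
      simpa using ((hx0.const_mul 2).add (hy0.const_mul 2)).add (hz0.const_mul 2)
    refine squeeze_zero' (Eventually.of_forall fun n =>
      bernoulliError_nonneg (balancedProb_mem _).1 (balancedProb_mem _).2 _ _) ?_ hlim2
    have half : (0 : ℝ) < 1 / 2 := by norm_num
    filter_upwards [h0, eventually_le_of_tendsto_ratio hN, hN.eventually_ge_atTop 1, hk,
      hx0.eventually_le_const half, hy0.eventually_le_const half, hz0.eventually_le_const half]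
      with n h1 h2 h3 hkn hxn hyn hzn
    have hN0 : 0 < (n : ℝ) / k n := by linarith
    have hk0 : (0 : ℝ) < k n := by exact_mod_cast h1
    have hxp : 0 ≤ x n := by positivity
    have hyp : 0 ≤ y n := by positivity
    have hzp : 0 ≤ z n := by positivity
    have hTn : k n * (Real.log ((n : ℝ) / k n) / R) - Real.log 2 ≤ T n * Real.log 2 := by
      have h4 := (Nat.lt_floor_add_one (k n * Real.logb 2 ((n : ℝ) / k n) / R)).le
      have h5 := mul_le_mul_of_nonneg_right h4 hlog2.le
      have e : k n * Real.logb 2 ((n : ℝ) / k n) / R * Real.log 2 =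
          k n * (Real.log ((n : ℝ) / k n) / R) := by
        rw [Real.logb]
        field_simp
      rw [e] at h5
      linarith
    refine (bernoulliError_consistentDetector_le (balancedProb_mem _).1 (balancedProb_mem _).2 h2
      (fun l => x n ^ l + y n ^ l + z n ^ l) fun l hl K hK => ?_).trans ?_
    · obtain ⟨hl1, hlk⟩ := Finset.mem_Icc.1 hl
      have hl0 : (0 : ℝ) < l := by exact_mod_cast hl1
      have hq : (1 - balancedProb (k n)) ^ k n = 1 / 2 := by
        rw [one_sub_balancedProb_pow, div_self hk0.ne', one_mul, Real.exp_neg,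
          Real.exp_log two_pos, one_div]
      have px := pow_nonneg hxp l
      have py := pow_nonneg hyp l
      have pz := pow_nonneg hzp l
      rcases le_total (κ * k n) l with hκl | hκl
      · have h6 := designExp_confused_le (T := T n) (l := l) (balancedProb_mem _).1
          (balancedProb_mem _).2 hK hq
        have h7 := union_bound_le hκ0 hl1 hlk hκl hN0 hTn
        have h8 := h6.trans h7
        have e : x n ^ l = (2 ^ (1 / κ) * (Real.exp 1 / κ) * 2 *
          ((n : ℝ) / k n) ^ (1 - 1 / (R : ℝ))) ^ l := rfl
        rw [← e] at h8
        linarith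
      · have hh : 0 < 1 - (1 - balancedProb (k n)) ^ l := by
          rw [one_sub_balancedProb_pow, sub_pos, Real.exp_lt_one_iff, neg_lt_zero]
          positivity
        have h6 := designExp_confused_le_of_pivotal (T := T n) (l := l)
          (m := δ * l * Real.log ((n : ℝ) / k n)) (balancedProb_mem _).1
          (balancedProb_mem _).2 hK hB1.le hh
        have h7 := pivotal_chernoff_le (δ := δ) hB1.le hl1 hlk hTn
        have h8 := meet_all_pivotal_le hδ0 hl1 h3 ((div_le_iff₀ hk0).2 hκl)
        rw [hexp] at h7
        have hck : ((k n).choose l : ℝ) ≤ (C * ((n : ℝ) / k n) ^ (1 / 2 : ℝ)) ^ l := by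
          have h9 : ((k n).choose l : ℝ) ≤ (k n : ℝ) ^ l := by
            exact_mod_cast Nat.choose_le_pow (k n) l
          exact h9.trans (pow_le_pow_left₀ hk0.le hkn l)
        have hcn : (n.choose l : ℝ) ≤
            (C * ((n : ℝ) / k n) ^ (1 / 2 : ℝ) * ((n : ℝ) / k n)) ^ l := by
          have h9 : (n.choose l : ℝ) ≤ (n : ℝ) ^ l := by exact_mod_cast Nat.choose_le_pow n l
          refine h9.trans (pow_le_pow_left₀ (Nat.cast_nonneg n) ?_ l)
          calc (n : ℝ) = k n * ((n : ℝ) / k n) := by field_simp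
            _ ≤ _ := by gcongr
        have hfin : ((k n).choose l : ℝ) * (B ^ (δ * l * Real.log ((n : ℝ) / k n)) *
            (1 - (1 - B⁻¹) * ((1 - balancedProb (k n)) ^ (k n - l) -
              (1 - balancedProb (k n)) ^ k n)) ^ T n +
            n.choose l * (1 - (1 - balancedProb (k n)) ^ l) ^ (δ * l * Real.log ((n : ℝ) / k n))) ≤
            y n ^ l + z n ^ l := by
          rw [mul_add]
          refine add_le_add ?_ ?_
          · calc _ ≤ (C * ((n : ℝ) / k n) ^ (1 / 2 : ℝ)) ^ l *
                  Real.exp (1 + -(1 / 2 + η) * Real.log ((n : ℝ) / k n)) ^ l :=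
                (mul_le_mul_of_nonneg_left h7 (Nat.cast_nonneg _)).trans
                  (mul_le_mul_of_nonneg_right hck (by positivity))
              _ = y n ^ l := by
                rw [← mul_pow, Real.exp_add, mul_comm (-(1 / 2 + η)), ← Real.rpow_def_of_pos hN0]
                congr 1
                have e : ((n : ℝ) / k n) ^ (-η) =
                    ((n : ℝ) / k n) ^ (1 / 2 : ℝ) * ((n : ℝ) / k n) ^ (-(1 / 2 + η)) := by
                  rw [← Real.rpow_add hN0]
                  ring_nf
                simp only [hy]
                rw [e]
                ring
          · calc _ ≤ (C * ((n : ℝ) / k n) ^ (1 / 2 : ℝ)) ^ l *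
                  ((C * ((n : ℝ) / k n) ^ (1 / 2 : ℝ) * ((n : ℝ) / k n)) ^ l *
                    (((n : ℝ) / k n) ^ (-3 : ℝ)) ^ l) := by gcongr
              _ = z n ^ l := by
                rw [← mul_pow, ← mul_pow]
                congr 1
                have e : ((n : ℝ) / k n) ^ (-1 : ℝ) = ((n : ℝ) / k n) ^ (1 / 2 : ℝ) *
                    ((n : ℝ) / k n) ^ (1 / 2 : ℝ) * ((n : ℝ) / k n) *
                      ((n : ℝ) / k n) ^ (-3 : ℝ) := by
                  rw [← Real.rpow_add hN0, ← Real.rpow_add_one hN0.ne', ← Real.rpow_add hN0]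
                  norm_num
                simp only [hz]
                rw [e]
                ring
        linarith [h6.trans hfin]
    · rw [Finset.sum_add_distrib, Finset.sum_add_distrib]
      linarith [sum_Icc_pow_le hxp hxn (k n), sum_Icc_pow_le hyp hyn (k n),
        sum_Icc_pow_le hzp hzn (k n)]

/-! ### Bernoulli testing of denser defective sets -/

theorem half_le_bernoulliError_of_biased {n k T : ℕ} {p δ R : ℝ} (hp0 : 0 ≤ p) (hp1 : p ≤ 1)
    (hk : k ≤ n) (D : Detector n T) (h0 : 0 ≤ δ) (h1 : δ ≤ 1 / 4) (hR : 1 - δ ^ 2 / 4 ≤ R)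
    (hT : R * T ≤ bits n k) (hbits : Real.exp (-(δ ^ 2 / 8 * bits n k)) ≤ 1 / 4) (b : Bool)
    (hb : (if b = true then 1 - (1 - p) ^ k else (1 - p) ^ k) ≤ 1 / 2 - δ) :
    1 / 2 ≤ bernoulliError p k D := by
  have hlog2 : 1 / 2 < Real.log 2 := by linarith [Real.log_two_gt_d9]
  have hlog2' : Real.log 2 < 1 := by linarith [Real.log_two_lt_d9]
  have hδ2 : δ ^ 2 ≤ 1 / 16 := by nlinarith
  have hδ0 := sq_nonneg δ
  have hb0 : 0 ≤ bits n k :=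
    Real.logb_nonneg one_lt_two (by exact_mod_cast Nat.choose_pos hk)
  have hTpow : (2 : ℝ) ^ T = Real.exp (T * Real.log 2) := by
    rw [Real.exp_nat_mul, Real.exp_log two_pos]
  have hchoose : (n.choose k : ℝ) = Real.exp (bits n k * Real.log 2) := by
    rw [← two_rpow_bits hk, Real.rpow_def_of_pos two_pos, mul_comm]
  rcases le_total (T : ℝ) (bits n k / 2) with hT2 | hT2
  · have h2 := le_bernoulliError_of_card hp0 hp1 hk D
    have h3 : (2 : ℝ) ^ T / n.choose k ≤ 1 / 4 := by
      refine le_trans ?_ hbits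
      rw [hTpow, hchoose, ← Real.exp_sub, Real.exp_le_exp]
      have := mul_le_mul_of_nonneg_right hT2 (by linarith : 0 ≤ Real.log 2)
      nlinarith
    linarith
  · have h2 := le_bernoulliError_of_biased hp0 hp1 hk D b h0 (by linarith) hb
    have h3 : Real.exp (-(δ ^ 2 / 4)) ^ T ≤ 1 / 4 := by
      refine le_trans ?_ hbits
      rw [← Real.exp_nat_mul, Real.exp_le_exp]
      nlinarith
    have h4 : 2 ^ T * Real.exp (-(δ ^ 2 / 2)) ^ T / n.choose k ≤ 1 / 4 := by
      refine le_trans ?_ hbits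
      rw [hTpow, hchoose, ← Real.exp_nat_mul, ← Real.exp_add, ← Real.exp_sub, Real.exp_le_exp]
      -- The saving `δ ^ 2 / 2` in the exponent outweighs the loss of `δ ^ 2 / 4` from `R < 1`.
      have h5 : T * (Real.log 2 - δ ^ 2 / 2) ≤ bits n k * (Real.log 2 - δ ^ 2 / 4) := by
        have h6 : Real.log 2 - δ ^ 2 / 2 ≤ R * (Real.log 2 - δ ^ 2 / 4) := by
          nlinarith [mul_le_mul_of_nonneg_right hR (by linarith : 0 ≤ Real.log 2 - δ ^ 2 / 4)]
        have h7 := mul_le_mul_of_nonneg_left h6 (Nat.cast_nonneg (α := ℝ) T)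
        have h8 := mul_le_mul_of_nonneg_right hT (by linarith : 0 ≤ Real.log 2 - δ ^ 2 / 4)
        linarith
      nlinarith
    linarith

theorem choose_pred_div_choose_le {n k : ℕ} (h0 : 1 ≤ k) (hk : 5 * k ≤ n) :
    (n.choose (k - 1) : ℝ) / n.choose k ≤ 1 / 4 := by
  obtain ⟨j, rfl⟩ : ∃ j, k = j + 1 := ⟨k - 1, by omega⟩
  have h1 : 0 < n.choose (j + 1) := Nat.choose_pos (by omega)
  have h2 := Nat.choose_succ_right_eq n j
  rw [Nat.add_sub_cancel, div_le_div_iff₀ (by exact_mod_cast h1) (by norm_num)]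
  have h3 : n.choose j * (4 * (j + 1)) ≤ n.choose j * (n - j) :=
    Nat.mul_le_mul_left _ (by omega)
  have h4 : n.choose j * 4 ≤ 1 * n.choose (j + 1) := by
    refine Nat.le_of_mul_le_mul_right (c := j + 1) ?_ (Nat.succ_pos j)
    calc n.choose j * 4 * (j + 1) = n.choose j * (4 * (j + 1)) := by ring
      _ ≤ _ := h3
      _ = _ := by rw [← h2, one_mul]
  exact_mod_cast h4

/-- If the tests are nearly balanced, then some defective is masked with high probability as soon as
`k` is a little larger than `(n / k) ^ (1 / 2)`. -/
theorem half_le_bernoulliError_of_balanced {n k T : ℕ} {p δ R c β γ γ₁ γ₂ : ℝ} (hp0 : 0 ≤ p)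
    (hp1 : p ≤ 1) (hk4 : 4 ≤ k) (hkn : 5 * k ≤ n) (D : Detector n T) (h1 : δ ≤ 1 / 4)
    (hq1 : 1 / 2 - δ ≤ (1 - p) ^ k) (hq2 : (1 - p) ^ k ≤ 1 / 2 + δ)
    (hδγ : (1 / 2 + δ) * -Real.log (1 / 2 - δ) ≤ γ₁ * Real.log 2) (hγ₂ : 0 < γ₂)
    (hγR : γ₁ ≤ γ₂ * R) (hγ : γ₂ ≤ γ * (1 - 2 / (k : ℝ)) ^ 2)
    (hT : R * T ≤ bits n k) (hc : c * ((n : ℝ) / k) ^ β ≤ k)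
    (hbig : 4 ≤ c * Real.exp (-γ) * ((n : ℝ) / k) ^ (β - γ)) :
    1 / 2 ≤ bernoulliError p k D := by
  have hlog2 : 0 < Real.log 2 := Real.log_pos one_lt_two
  have hk0 : (4 : ℝ) ≤ k := by exact_mod_cast hk4
  have hkn' : k ≤ n := by omega
  have hN : 1 ≤ (n : ℝ) / k := by
    rw [le_div_iff₀ (by linarith), one_mul]
    exact_mod_cast hkn'
  have hN0 : 0 < (n : ℝ) / k := by linarith
  have hlogN := Real.log_nonneg hN
  obtain ⟨x, hx⟩ : ∃ x, x = 1 - p := ⟨_, rfl⟩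
  have hpx : p = 1 - x := by linarith
  rw [← hx] at hq1 hq2
  have hx0 : 0 < x := by
    refine lt_of_le_of_ne (by linarith) fun h => ?_
    rw [← h, zero_pow (by omega)] at hq1
    linarith
  set s : ℝ := -Real.log (1 / 2 - δ) with hs
  have hs2 : s ≤ 2 := by
    have h2 : Real.log (1 / 4) ≤ Real.log (1 / 2 - δ) :=
      Real.log_le_log (by norm_num) (by linarith)
    have h3 : Real.log (1 / 4) = -(2 * Real.log 2) := by
      rw [show (1 / 4 : ℝ) = (2 ^ 2)⁻¹ by norm_num, Real.log_inv, Real.log_pow]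
      norm_num
    linarith [Real.log_two_lt_d9]
  have hkp : k * p ≤ s := by
    have h2 := Real.log_le_log (by linarith) hq1
    rw [Real.log_pow] at h2
    have h3 : Real.log x ≤ x - 1 := Real.log_le_sub_one_of_pos hx0
    have h4 := mul_le_mul_of_nonneg_left h3 (by linarith : (0 : ℝ) ≤ k)
    rw [hpx]
    linarith
  have hs0 : 0 ≤ s := le_trans (by positivity) hkp
  have hpk : p ≤ 2 / k := by
    rw [le_div_iff₀ (by linarith)]
    linarith
  have h2k : 2 / (k : ℝ) ≤ 1 / 2 := by
    rw [div_le_div_iff₀ (by linarith) two_pos]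
    linarith
  set w : ℝ := 1 - 2 / (k : ℝ) with hw
  have hw0 : 0 < w := by linarith
  have hxw : w ≤ x := by linarith
  set a := p * x ^ (k - 1) with ha
  have ha0 : 0 ≤ a := by positivity
  have hap : a ≤ p := mul_le_of_le_one_right hp0 (pow_le_one₀ hx0.le (by linarith))
  have hax : a * x = p * x ^ k := by
    rw [ha, mul_assoc, ← pow_succ, Nat.sub_add_cancel (by omega)]
  have ha1 : 0 < 1 - a := by linarith
  have hka : k * a * w ≤ γ₁ * Real.log 2 := by
    calc k * a * w ≤ k * a * x := by gcongr
      _ = k * p * x ^ k := by rw [mul_assoc, hax]; ring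
      _ ≤ s * (1 / 2 + δ) := by gcongr
      _ ≤ _ := by linarith
  have hγ₁ : 0 ≤ γ₁ := by
    by_contra h
    have h5 : 0 ≤ k * a * w := by positivity
    nlinarith [not_le.1 h]
  -- The exponent in `(1 - a) ^ T ≥ exp (-T * a / (1 - a))`.
  have hexpo : T * (a / (1 - a)) ≤ γ * (Real.log ((n : ℝ) / k) + 1) := by
    have h5 : a / (1 - a) ≤ γ₁ * Real.log 2 / (k * w ^ 2) := by
      rw [div_le_div_iff₀ ha1 (by positivity)]
      calc a * (k * w ^ 2) = k * a * w * w := by ring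
        _ ≤ γ₁ * Real.log 2 * w := by gcongr
        _ ≤ γ₁ * Real.log 2 * (1 - a) := by
          gcongr
          linarith
    have h6 : R * T * Real.log 2 ≤ k * (Real.log ((n : ℝ) / k) + 1) :=
      (mul_le_mul_of_nonneg_right hT hlog2.le).trans (bits_mul_log_two_le (by omega) hkn')
    calc T * (a / (1 - a)) ≤ T * (γ₁ * Real.log 2 / (k * w ^ 2)) := by gcongr
      _ ≤ T * (γ₂ * R * Real.log 2 / (k * w ^ 2)) := by gcongr
      _ = γ₂ / (k * w ^ 2) * (R * T * Real.log 2) := by ring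
      _ ≤ γ₂ / (k * w ^ 2) * (k * (Real.log ((n : ℝ) / k) + 1)) := by gcongr
      _ = γ₂ / w ^ 2 * (Real.log ((n : ℝ) / k) + 1) := by
        field_simp
      _ ≤ γ * (Real.log ((n : ℝ) / k) + 1) := by
        gcongr
        rw [div_le_iff₀ (by positivity)]
        exact hγ
  have hμ : Real.exp (-(γ * (Real.log ((n : ℝ) / k) + 1))) ≤ (1 - a) ^ T := by
    rw [← Real.exp_log ha1, ← Real.exp_nat_mul, Real.exp_le_exp]
    have h5 := Real.one_sub_inv_le_log_of_pos ha1
    have h6 : 1 - (1 - a)⁻¹ = -(a / (1 - a)) := by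
      field_simp
      ring
    rw [h6] at h5
    have h7 := mul_le_mul_of_nonneg_left h5 (Nat.cast_nonneg (α := ℝ) T)
    linarith
  have hkμ : 4 ≤ k * (1 - a) ^ T := by
    have hc0 : 0 < c := by
      by_contra h
      have : c * Real.exp (-γ) * ((n : ℝ) / k) ^ (β - γ) ≤ 0 := by
        refine mul_nonpos_of_nonpos_of_nonneg ?_ (by positivity)
        exact mul_nonpos_of_nonpos_of_nonneg (not_lt.1 h) (Real.exp_pos _).le
      linarith
    calc (4 : ℝ) ≤ c * Real.exp (-γ) * ((n : ℝ) / k) ^ (β - γ) := hbig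
      _ = c * ((n : ℝ) / k) ^ β * Real.exp (-(γ * (Real.log ((n : ℝ) / k) + 1))) := by
        rw [mul_add, mul_one, neg_add, Real.exp_add, sub_eq_add_neg, Real.rpow_add hN0,
          Real.rpow_def_of_pos hN0 (-γ)]
        ring_nf
      _ ≤ k * (1 - a) ^ T := by gcongr
  have hmain := le_bernoulliError_of_masked hp0 hp1 hkn' (by rw [← hx]; linarith) (by omega) D
  rw [← hx, ← ha] at hmain
  have h8 : 1 / (k * (1 - a) ^ T) ≤ 1 / 4 := one_div_le_one_div_of_le (by norm_num) hkμ
  have h9 := choose_pred_div_choose_le (by omega) hkn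
  linarith

/-- At `δ = 0` the left-hand side is `log 2 / 2`. -/
theorem exists_balance_tolerance {γ₁ : ℝ} (h : 1 / 2 < γ₁) :
    ∃ δ : ℝ, 0 < δ ∧ δ ≤ 1 / 4 ∧ (1 / 2 + δ) * -Real.log (1 / 2 - δ) ≤ γ₁ * Real.log 2 := by
  have hcont : ContinuousAt (fun δ : ℝ => (1 / 2 + δ) * -Real.log (1 / 2 - δ)) 0 := by
    refine ContinuousAt.mul (by fun_prop) (ContinuousAt.neg (ContinuousAt.log (by fun_prop) ?_))
    norm_num
  have hlog2 : 0 < Real.log 2 := Real.log_pos one_lt_two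
  have h0 : (1 / 2 + (0 : ℝ)) * -Real.log (1 / 2 - 0) < γ₁ * Real.log 2 := by
    rw [sub_zero, add_zero, one_div, Real.log_inv, neg_neg]
    nlinarith
  have h1 : ∀ᶠ δ : ℝ in 𝓝[>] 0, (1 / 2 + δ) * -Real.log (1 / 2 - δ) ≤ γ₁ * Real.log 2 :=
    nhdsWithin_le_nhds (hcont.eventually_le_const h0)
  have h2 : ∀ᶠ δ : ℝ in 𝓝[>] 0, δ ≤ 1 / 4 :=
    nhdsWithin_le_nhds (eventually_le_nhds (by norm_num))
  obtain ⟨δ, hδ1, hδ2, hδ3⟩ := (h1.and (h2.and self_mem_nhdsWithin)).exists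
  exact ⟨δ, hδ3, hδ2, hδ1⟩

/-- For `θ > 1 / 3`, the capacity is bounded away from `1`: tests that are far from balanced carry
too little information, and nearly balanced tests leave a defective masked. -/
theorem exists_bernoulliCapacity_le {θ : ℝ} (hθ : 1 / 3 < θ) (hθ1 : θ < 1) :
    ∃ C : ℝ≥0, C < 1 ∧ ∀ k : ℕ → ℕ, (fun n => (k n : ℝ)) =Θ[atTop] (fun n : ℕ => (n : ℝ) ^ θ) →
      bernoulliCapacity k ≤ C := by
  set β := θ / (1 - θ) with hβ
  have hβ2 : 1 / 2 < β := by
    rw [hβ, lt_div_iff₀ (by linarith)]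
    linarith
  -- Room between `1 / 2` and `β` for the tolerance `δ`, for `R < 1`, and for the error terms at finite `k`.
  obtain ⟨γ₁, h1, h1'⟩ := exists_between hβ2
  obtain ⟨γ₂, h2, h2'⟩ := exists_between h1'
  obtain ⟨γ, h3, h3'⟩ := exists_between h2'
  obtain ⟨δ, hδ0, hδ4, hδγ⟩ := exists_balance_tolerance h1
  have hC0 : 0 ≤ max (γ₁ / γ₂) (1 - δ ^ 2 / 4) :=
    le_max_of_le_left (div_nonneg (by linarith) (by linarith))
  refine ⟨(max (γ₁ / γ₂) (1 - δ ^ 2 / 4)).toNNReal, ?_, fun k hk => ?_⟩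
  · rw [Real.toNNReal_lt_one]
    refine max_lt ?_ ?_
    · rw [div_lt_iff₀ (by linarith)]
      simpa using h2
    · have : 0 < δ ^ 2 := by positivity
      linarith
  · have h0 := eventually_pos_of_isTheta hk
    have hN := tendsto_ratio_of_isTheta hθ1 hk
    obtain ⟨c, hc0, hc⟩ := rpow_ratio_le_of_isTheta hθ1 hk
    have hkt : Tendsto (fun n => (k n : ℝ)) atTop atTop :=
      tendsto_atTop_mono' _ hc
        (((tendsto_rpow_atTop (by linarith : 0 < β)).comp hN).const_mul_atTop hc0)
    refine supRate_le fun R hR ⟨T, p, D, hp, hT, he⟩ => ?_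
    have hR' : max (γ₁ / γ₂) (1 - δ ^ 2 / 4) < (R : ℝ) :=
      (Real.toNNReal_lt_iff_lt_coe hC0).1 hR
    have hR1 := (le_max_left _ _).trans hR'.le
    have hR2 := (le_max_right _ _).trans hR'.le
    rw [div_le_iff₀ (by linarith)] at hR1
    refine not_tendsto_zero_of_half_le ?_ he
    have hbits : ∀ᶠ n in atTop, Real.exp (-(δ ^ 2 / 8 * bits n (k n))) ≤ 1 / 4 := by
      have : Tendsto (fun n => δ ^ 2 / 8 * bits n (k n)) atTop atTop :=
        (tendsto_bits h0 hN).const_mul_atTop (by positivity)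
      exact (Real.tendsto_exp_neg_atTop_nhds_zero.comp this).eventually_le_const (by norm_num)
    have hwk : ∀ᶠ n in atTop, γ₂ ≤ γ * (1 - 2 / (k n : ℝ)) ^ 2 := by
      have : Tendsto (fun n => γ * (1 - 2 / (k n : ℝ)) ^ 2) atTop (𝓝 (γ * (1 - 0) ^ 2)) :=
        ((tendsto_const_nhds.sub (tendsto_const_nhds.div_atTop hkt)).pow 2).const_mul γ
      exact this.eventually_const_le (by simpa using h3)
    have hbig : ∀ᶠ n : ℕ in atTop, 4 ≤ c * Real.exp (-γ) * ((n : ℝ) / k n) ^ (β - γ) :=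
      (((tendsto_rpow_atTop (by linarith : 0 < β - γ)).comp hN).const_mul_atTop
        (by positivity : 0 < c * Real.exp (-γ))).eventually_ge_atTop 4
    filter_upwards [hT, h0, hc, hbits, hwk, hbig, hkt.eventually_ge_atTop 4,
      hN.eventually_ge_atTop 5, eventually_le_of_tendsto_ratio hN]
      with n e1 e2 e3 e4 e5 e6 e7 e8 e9
    by_cases hq1 : (1 - p n) ^ k n ≤ 1 / 2 - δ
    · exact half_le_bernoulliError_of_biased (hp n).1 (hp n).2 e9 (D n) hδ0.le hδ4 hR2 e1 e4 false
        (by simpa using hq1)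
    by_cases hq2 : 1 / 2 + δ ≤ (1 - p n) ^ k n
    · refine half_le_bernoulliError_of_biased (hp n).1 (hp n).2 e9 (D n) hδ0.le hδ4 hR2 e1 e4
        true ?_
      rw [if_pos rfl]
      linarith
    rw [le_div_iff₀ (by exact_mod_cast e2)] at e8
    exact half_le_bernoulliError_of_balanced (hp n).1 (hp n).2 (by exact_mod_cast e7)
      (by exact_mod_cast e8) (D n) hδ4 (not_le.1 hq1).le (not_le.1 hq2).le hδγ (by linarith)
      (by linarith) e5 e1 e3 e6

end GroupTesting

theorem mainTheorem5 (θ : ℝ) (hθ0 : 0 ≤ θ) (hθ1 : θ < 1) :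
    (θ ≤ 1 / 3 →
      ∀ k : ℕ → ℕ, (fun n => (k n : ℝ)) =Θ[atTop] (fun n : ℕ => (n : ℝ) ^ θ) →
        GroupTesting.bernoulliCapacity k = 1 ∧ GroupTesting.adaptiveCapacity k = 1) ∧
    (1 / 3 < θ →
      ∃ C : ℝ≥0∞, C < 1 ∧
        ∀ k : ℕ → ℕ, (fun n => (k n : ℝ)) =Θ[atTop] (fun n : ℕ => (n : ℝ) ^ θ) →
          GroupTesting.bernoulliCapacity k ≤ C ∧
          GroupTesting.adaptiveCapacity k = 1 ∧ GroupTesting.hwangRate k = 1) := by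
  have hadaptive : ∀ k : ℕ → ℕ, (fun n => (k n : ℝ)) =Θ[atTop] (fun n : ℕ => (n : ℝ) ^ θ) →
      GroupTesting.adaptiveCapacity k = 1 ∧ GroupTesting.hwangRate k = 1 := by
    intro k hk
    have h0 := GroupTesting.eventually_pos_of_isTheta hk
    have hN := GroupTesting.tendsto_ratio_of_isTheta hθ1 hk
    have h1 := GroupTesting.adaptiveCapacity_le_one h0 hN
    have h2 := GroupTesting.one_le_hwangRate h0 hN
    have h3 := GroupTesting.hwangRate_le_adaptiveCapacity k
    exact ⟨le_antisymm h1 (h2.trans h3), le_antisymm (h3.trans h1) h2⟩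
  refine ⟨fun hθ k hk => ⟨?_, (hadaptive k hk).1⟩, fun hθ => ?_⟩
  · have h0 := GroupTesting.eventually_pos_of_isTheta hk
    have hN := GroupTesting.tendsto_ratio_of_isTheta hθ1 hk
    obtain ⟨C, hC, hkC⟩ := GroupTesting.le_sqrt_ratio_of_isTheta hθ hk
    exact le_antisymm (GroupTesting.bernoulliCapacity_le_one h0 hN)
      (GroupTesting.one_le_supRate fun R hR0 hR1 =>
        GroupTesting.bernoulliAchievable_of_lt_one h0 hN hC hkC hR0 hR1)
  · obtain ⟨C, hC, h⟩ := GroupTesting.exists_bernoulliCapacity_le hθ hθ1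
    exact ⟨C, by exact_mod_cast hC, fun k hk => ⟨h k hk, hadaptive k hk⟩⟩
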